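/- Consider a bandit with $K$ arms over the times $1,\dots,T$. The true rewards satisfy $X_t(i)\in[0,1]$, the reward vector $X_t=(X_t(i))_{i\le K}$ of each round is independent of everything that happened in the earlier rounds, and $\mu_t(i)=\mathbb E[X_t(i)]$. The environment changes abruptly: $\beta_T\ge 1$ is the number of breakpoints, i.e. of times $1\le t<T$ at which the distribution of the reward of some arm differs between $t$ and $t+1$. At every time $t$ there is a best arm $a_t^*$ with $\mu_t(a_t^*)-\mu_t(i)\ge\Delta$ for all $i\ne a_t^*$, where $\Delta>0$. Let $\gamma\in(0,1)$. After the first $t$ rounds, with pulled arms $a_s$ and received feedback $r_s$ ($s\le t$), put $$N_t(\gamma,i)=\sum_{s=1}^t\gamma^{t-s}\mathbf 1(a_s=i),\qquad \bar X_t(\gamma,i)=\frac1{N_t(\gamma,i)}\sum_{s=1}^t\gamma^{t-s}\mathbf 1(a_s=i)\,r_s$$ (with $\bar X_t(\gamma,i)=0$ if $i$ has not been pulled), $n_t(\gamma)=\sum_i N_t(\gamma,i)$ and $c_t(\gamma,i)=2\sqrt{\xi\log n_t(\gamma)/N_t(\gamma,i)}$ with $\xi>1/2$. The principal recommends arms by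 Discounted UCB: $a_t=t$ for $t\le K$, and for $t>K$ the arm $a_t$ maximizes $\bar X_{t-1}(\gamma,\cdot)+c_{t-1}(\gamma,\cdot)$; ties are broken arbitrarily, without knowledge of the present and future rewards. Let $g_t$ be a maximizer of $\bar X_{t-1}(\gamma,\cdot)$ (the greedy choice). The agent pulls $a_t$. If $a_t\neq g_t$, the principal pays the compensation $\chi_t=\bar X_{t-1}(\gamma,g_t)-\bar X_{t-1}(\gamma,a_t)$ and the feedback is $r_t=X_t(a_t)+f_t(\chi_t)$, where $f_t$ is non-decreasing, $f_t(0)=0$, and $f_t$ is Lipschitz with constant at most $l$; if $a_t=g_t$, then $r_t=X_t(a_t)$. The total compensation contributed by arm $a$ is $$C_T(a)=\sum_{t\le T,\ a_t=a}\bigl(\bar X_{t-1}(\gamma,g_t)-\bar X_{t-1}(\gamma,a_t)\bigr).$$ Let the discount factor be $\gamma=1-c\sqrt{\beta_T/T}$ with a tuning constant $c>0$, and suppose $\gamma\ge\gamma_0$ for a constant $\gamma_0>0$ (which is automatic with $\gamma_0=1-c$ if $c<1$). Then there is a constant $\eta>0$, depending only on $K,\xi,l,\Delta,c,\gamma_0$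 (and not on $T$, $\beta_T$, the reward distributions or the drift functions), such that for every arm $a$ the variable $C_T(a)$ is integrable and $$\mathbb E[C_T(a)]\le\eta\,\beta_T^{3/2}\,\sqrt T\,(\log T)^{3/2}.$$ -/

import Mathlib

open MeasureTheory ProbabilityTheory
open scoped NNReal

noncomputable section

namespace IncentivizedBandit

/-! Time runs over `1, 2, …, T`; the arms are the elements of `Fin K`.  In the first block, `A s` is
the arm pulled at time `s` and `r s` the feedback received at time `s` (along one trajectory). -/

/-- Discounted frequency `N_t(γ, i) = ∑_{s=1}^t γ^(t-s) 1(a_s = i)`. -/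
def discCount {K : ℕ} (γ : ℝ) (A : ℕ → Fin K) (t : ℕ) (i : Fin K) : ℝ :=
  ∑ s ∈ Finset.Icc 1 t, if A s = i then γ ^ (t - s) else 0

/-- Discounted empirical average `X̄_t(γ, i)` of the received feedback, drift included
(equal to `0` for an arm that has not been pulled yet). -/
def discMean {K : ℕ} (γ : ℝ) (A : ℕ → Fin K) (r : ℕ → ℝ) (t : ℕ) (i : Fin K) : ℝ :=
  (∑ s ∈ Finset.Icc 1 t, if A s = i then γ ^ (t - s) * r s else 0) / discCount γ A t i

/-- `n_t(γ) = ∑_i N_t(γ, i)`. -/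
def discTotal {K : ℕ} (γ : ℝ) (A : ℕ → Fin K) (t : ℕ) : ℝ :=
  ∑ i, discCount γ A t i

/-- Discounted confidence radius `c_t(γ, i) = 2 √(ξ log n_t(γ) / N_t(γ, i))`. -/
def discRadius {K : ℕ} (ξ γ : ℝ) (A : ℕ → Fin K) (t : ℕ) (i : Fin K) : ℝ :=
  2 * √(ξ * Real.log (discTotal γ A t) / discCount γ A t i)

/-- Discounted upper confidence bound `X̄_t(γ, i) + c_t(γ, i)`. -/
def discUCB {K : ℕ} (ξ γ : ℝ) (A : ℕ → Fin K) (r : ℕ → ℝ) (t : ℕ) (i : Fin K) : ℝ :=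
  discMean γ A r t i + discRadius ξ γ A t i

/-- The recommendations `A` follow discounted UCB up to time `T`: pull arm number `t` at each time
`t ≤ K` (the arm with index `t - 1` in `Fin K`), afterwards pull an arm that maximizes the upper
confidence bound computed from the feedback of the earlier rounds, ties being broken arbitrarily. -/
structure IsDUCB {K : ℕ} (T : ℕ) (ξ γ : ℝ) (A : ℕ → Fin K) (r : ℕ → ℝ) : Prop where
  init : ∀ t, t < T → t < K → (A (t + 1) : ℕ) = t
  argmax : ∀ t, t < T → K ≤ t → ∀ i, discUCB ξ γ A r t i ≤ discUCB ξ γ A r t (A (t + 1))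

/-- The compensation `X̄(g_t) - X̄(a_t)` offered at time `t + 1`, computed from the feedback of the
rounds `1, …, t`. -/
def compensation {K : ℕ} (γ : ℝ) (A g : ℕ → Fin K) (r : ℕ → ℝ) (t : ℕ) : ℝ :=
  discMean γ A r t (g (t + 1)) - discMean γ A r t (A (t + 1))

/-- Incentivized play under reward drift up to time `T`, with true rewards `x`, recommended (and
pulled) arms `A`, greedy arms `g`, feedback `r` and drift functions `f`. -/
structure IsIncentivizedRun {K : ℕ} (T : ℕ) (γ : ℝ) (f : ℕ → ℝ → ℝ) (x : ℕ → Fin K → ℝ)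
    (A g : ℕ → Fin K) (r : ℕ → ℝ) : Prop where
  greedy : ∀ t, t < T → ∀ i, discMean γ A r t i ≤ discMean γ A r t (g (t + 1))
  feedback_of_ne : ∀ t, t < T → A (t + 1) ≠ g (t + 1) →
    r (t + 1) = x (t + 1) (A (t + 1)) + f (t + 1) (compensation γ A g r t)
  feedback_of_eq : ∀ t, t < T → A (t + 1) = g (t + 1) → r (t + 1) = x (t + 1) (A (t + 1))

/-- Total compensation `C_T(a)` contributed by arm `a` up to time `T`: the sum of the compensations
over the times `1 ≤ t ≤ T` with `a_t = a`. -/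
def armCompensation {K : ℕ} (γ : ℝ) (A g : ℕ → Fin K) (r : ℕ → ℝ) (T : ℕ) (a : Fin K) : ℝ :=
  ∑ t ∈ Finset.range T, if A (t + 1) = a then compensation γ A g r t else 0

/-- Assumption on the reward drift: each `f_t`, `1 ≤ t ≤ T`, is non-decreasing, vanishes at `0` and
is Lipschitz with constant at most `l`. -/
structure IsDrift (T : ℕ) (l : ℝ≥0) (f : ℕ → ℝ → ℝ) : Prop where
  mono : ∀ t ∈ Finset.Icc 1 T, Monotone (f t)
  zero : ∀ t ∈ Finset.Icc 1 T, f t 0 = 0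
  lipschitz : ∀ t ∈ Finset.Icc 1 T, LipschitzWith l (f t)

section Environment

variable {Ω : Type*} {mΩ : MeasurableSpace Ω}

/-- True rewards with values in `[0, 1]`, where the reward vector of each round is observable at
that round and independent of the past.  The filtration may be larger than the one generated by
the rewards, so that the choices of the principal may also be randomized. -/
structure IsRewardProcess {K : ℕ} (T : ℕ) (P : Measure Ω) (ℱ : Filtration ℕ mΩ)
    (X : ℕ → Fin K → Ω → ℝ) : Prop where
  adapted : ∀ t ∈ Finset.Icc 1 T, ∀ i, Measurable[ℱ t] (X t i)
  mem_Icc : ∀ t ∈ Finset.Icc 1 T, ∀ i, ∀ᵐ ω ∂P, X t i ω ∈ Set.Icc (0 : ℝ) 1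
  indep : ∀ t, t < T →
    Indep (MeasurableSpace.comap (fun ω i => X (t + 1) i ω) MeasurableSpace.pi) (ℱ t) P

open Classical in
/-- The breakpoints before time `T`: the times `1 ≤ t < T` such that the reward distribution of
some arm at time `t + 1` differs from the one at time `t`. -/
def breakpoints {K : ℕ} (T : ℕ) (P : Measure Ω) (X : ℕ → Fin K → Ω → ℝ) : Finset ℕ :=
  (Finset.Ico 1 T).filter fun t => ∃ i, P.map (X (t + 1) i) ≠ P.map (X t i)

/-- At each time `1 ≤ t ≤ T` there is a best arm whose expected reward exceeds that of every other
arm by at least `Δ`. -/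
def HasGap {K : ℕ} (T : ℕ) (Δ : ℝ) (P : Measure Ω) (X : ℕ → Fin K → Ω → ℝ) : Prop :=
  ∀ t ∈ Finset.Icc 1 T, ∃ b : Fin K, ∀ i, i ≠ b → Δ ≤ (∫ ω, X t b ω ∂P) - ∫ ω, X t i ω ∂P

end Environment

end IncentivizedBandit

end

noncomputable section

namespace IncentivizedBandit

/-! Compensation is paid only when the pulled and the greedy arm differ, and by the UCB rule it is
at most the difference of their radii, hence at most a multiple of `√(log T / N)`, with `N` the
discounted count of the pulled arm. The proof bounds one compensation by a multiple of `√(log T)`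
and the expected number of paying rounds by a multiple of `√(β T) log T`.

The first bound needs a positive lower bound for all discounted counts, independent of `T`. This is
delicate: discounting makes a neglected arm forget its pulls, a small count allows a large
compensation, and the drift turns that compensation into feedback that keeps an arm attractive.
`WindowBound.succ` and `IsControlled.one_le_discCount_mul` break this circle by an induction on the
number of arms active in a time window, inside a strong induction on time. It follows that the
accumulated drift of an arm is only of order `√(N log T)` (`discSum_drift_le`), so it is negligible
against `N` once `N` is a large multiple of `log T`.

For the second bound, a paying round for arm `a` after the initialization is of one of three kinds
(`armCompensation_le`). It may lie within `D ≈ log T / (1 - γ)` rounds of the start or of a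
breakpoint; there are at most `(β + 1) D` of these. The count of `a` may be below `M log T`; the
discounted measure of such pulls is bounded, which leaves order `log T · (1 + (1 - γ) T)` rounds
(`card_pulls_le`). Or the rewards may deviate from their means, with probability of order `1 / n_t ≤
2 (1 - γ)`. In all other rounds the gap forces the compensation to vanish (`compensation_eq_zero`).
With `(1 - γ) T = c √(β T)` every contribution has order at most `√(β T) log T`, so the argument
yields `√β` where `β ^ (3/2)` is asked. -/

/-- Discounted sum `∑_{s=1}^t γ^(t-s) 1(a_s = i) w_s`. -/
def discSum {K : ℕ} (γ : ℝ) (A : ℕ → Fin K) (w : ℕ → ℝ) (t : ℕ) (i : Fin K) : ℝ :=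
  ∑ s ∈ Finset.Icc 1 t, if A s = i then γ ^ (t - s) * w s else 0

/-! ### Recursions and elementary bounds for discounted counts, sums and means. -/

section Discounted

variable {K : ℕ} {γ : ℝ} {A : ℕ → Fin K} {w r : ℕ → ℝ} {t : ℕ} {i : Fin K}

lemma discSum_zero : discSum γ A w 0 i = 0 := by simp [discSum]

lemma discSum_succ : discSum γ A w (t + 1) i =
    γ * discSum γ A w t i + if A (t + 1) = i then w (t + 1) else 0 := by
  unfold discSum
  rw [Finset.sum_Icc_succ_top (by omega), Finset.mul_sum]
  congr 1
  · refine Finset.sum_congr rfl fun s hs => ?_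
    have := (Finset.mem_Icc.1 hs).2
    rw [show t + 1 - s = (t - s) + 1 by omega]
    split_ifs <;> ring
  · simp

lemma discCount_eq_discSum : discCount γ A t i = discSum γ A (fun _ => 1) t i := by
  simp [discCount, discSum]

lemma discMean_eq : discMean γ A r t i = discSum γ A r t i / discCount γ A t i := rfl

lemma discCount_zero : discCount γ A 0 i = 0 := by simp [discCount]

lemma discCount_succ : discCount γ A (t + 1) i =
    γ * discCount γ A t i + if A (t + 1) = i then 1 else 0 := by
  rw [discCount_eq_discSum, discCount_eq_discSum, discSum_succ]

lemma discCount_nonneg (hγ : 0 ≤ γ) : 0 ≤ discCount γ A t i := by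
  unfold discCount
  refine Finset.sum_nonneg fun s _ => ?_
  split_ifs <;> positivity

lemma one_le_discCount_succ (hγ : 0 ≤ γ) (h : A (t + 1) = i) : 1 ≤ discCount γ A (t + 1) i := by
  rw [discCount_succ, if_pos h]
  have := mul_nonneg hγ (discCount_nonneg (A := A) (t := t) (i := i) hγ)
  linarith

lemma pow_le_discCount (hγ : 0 ≤ γ) {p : ℕ} (hp : 1 ≤ p) (hpt : p ≤ t) (h : A p = i) :
    γ ^ (t - p) ≤ discCount γ A t i := by
  unfold discCount
  have := Finset.single_le_sum (f := fun s => if A s = i then γ ^ (t - s) else 0)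
    (s := Finset.Icc 1 t) (fun s _ => by split_ifs <;> positivity)
    (Finset.mem_Icc.2 ⟨hp, hpt⟩)
  simpa [h] using this

lemma discCount_eq_of_not_pulled {u v : ℕ} (huv : u ≤ v) (h : ∀ s, u < s → s ≤ v → A s ≠ i) :
    discCount γ A v i = γ ^ (v - u) * discCount γ A u i := by
  induction v, huv using Nat.le_induction with
  | base => simp
  | succ v huv ih =>
    rw [discCount_succ, if_neg (h _ (by omega) le_rfl),
      ih fun s h1 h2 => h s h1 (by omega), show v + 1 - u = (v - u) + 1 by omega]
    ring

lemma discTotal_zero : discTotal γ A 0 = 0 := by simp [discTotal, discCount_zero]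

lemma discTotal_succ : discTotal γ A (t + 1) = γ * discTotal γ A t + 1 := by
  simp only [discTotal, discCount_succ, Finset.sum_add_distrib, Finset.mul_sum]
  simp

lemma one_sub_mul_discTotal : (1 - γ) * discTotal γ A t = 1 - γ ^ t := by
  induction t with
  | zero => simp [discTotal_zero]
  | succ t ih => rw [discTotal_succ]; linear_combination γ * ih

lemma discTotal_le (hγ : 0 ≤ γ) (hγ1 : γ ≤ 1) : discTotal γ A t ≤ t := by
  induction t with
  | zero => simp [discTotal_zero]
  | succ t ih =>
    rw [discTotal_succ]
    push_cast
    have : γ * discTotal γ A t ≤ γ * t := by gcongr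
    have : γ * t ≤ t := mul_le_of_le_one_left (by positivity) hγ1
    linarith

lemma discTotal_eq_sum : discTotal γ A t = ∑ j ∈ Finset.range t, γ ^ j := by
  induction t with
  | zero => simp [discTotal_zero]
  | succ t ih => rw [discTotal_succ, ih, Finset.sum_range_succ', Finset.mul_sum]; simp [pow_succ']

lemma discTotal_mono (hγ : 0 ≤ γ) : Monotone (discTotal γ A) := by
  refine monotone_nat_of_le_succ fun n => ?_
  rw [discTotal_eq_sum, discTotal_eq_sum, Finset.sum_range_succ]
  linarith [pow_nonneg hγ n]

lemma one_le_discTotal (hγ : 0 ≤ γ) (ht : 1 ≤ t) : 1 ≤ discTotal γ A t := by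
  have := discTotal_mono (A := A) hγ ht
  rw [discTotal_eq_sum] at this
  simpa using this

lemma discSum_le {B : ℝ} (hγ : 0 ≤ γ) (h : ∀ s, 1 ≤ s → s ≤ t → A s = i → w s ≤ B) :
    discSum γ A w t i ≤ B * discCount γ A t i := by
  unfold discSum discCount
  rw [Finset.mul_sum]
  refine Finset.sum_le_sum fun s hs => ?_
  rw [Finset.mem_Icc] at hs
  split_ifs with hA
  · rw [mul_comm]
    exact mul_le_mul_of_nonneg_right (h s hs.1 hs.2 hA) (pow_nonneg hγ _)
  · simp

lemma discSum_nonneg (hγ : 0 ≤ γ) (h : ∀ s, 1 ≤ s → s ≤ t → 0 ≤ w s) :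
    0 ≤ discSum γ A w t i := by
  unfold discSum
  refine Finset.sum_nonneg fun s hs => ?_
  rw [Finset.mem_Icc] at hs
  split_ifs
  · exact mul_nonneg (pow_nonneg hγ _) (h s hs.1 hs.2)
  · exact le_rfl

lemma discMean_nonneg (hγ : 0 ≤ γ) (h : ∀ s, 1 ≤ s → s ≤ t → 0 ≤ r s) :
    0 ≤ discMean γ A r t i :=
  div_nonneg (discSum_nonneg hγ h) (discCount_nonneg hγ)

lemma discMean_le {B : ℝ} (hγ : 0 ≤ γ) (hB : 0 ≤ B) (h : ∀ s, 1 ≤ s → s ≤ t → r s ≤ B) :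
    discMean γ A r t i ≤ B := by
  rw [discMean_eq]
  exact div_le_of_le_mul₀ (discCount_nonneg hγ) hB (discSum_le hγ fun s h1 h2 _ => h s h1 h2)

end Discounted

/-! ### A lower bound for the discounted counts, uniform in the horizon. -/

section LowerBound

variable {K : ℕ} {γ : ℝ} {A : ℕ → Fin K} {r : ℕ → ℝ}

/-- If between the times `u` and `v ≤ t` at most `k` arms are pulled, and some further arm has
discounted count at most `1` at time `u`, then the discount over the window is at least `y⁻²`. -/
def WindowBound (γ : ℝ) (A : ℕ → Fin K) (t k : ℕ) (y : ℝ) : Prop :=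
  ∀ (u v : ℕ) (S : Finset (Fin K)) (a : Fin K), K ≤ u → u ≤ v → v ≤ t → S.card ≤ k →
    (∀ s, u < s → s ≤ v → A s ∈ S) → a ∉ S → discCount γ A u a ≤ 1 → 1 ≤ γ ^ (v - u) * y ^ 2

lemma windowBound_zero (t : ℕ) : WindowBound γ A t 0 1 := by
  intro u v S a _ huv _ hS hA _ _
  have : S = ∅ := Finset.card_eq_zero.1 (by omega)
  subst this
  have : u = v := by
    by_contra h
    exact absurd (hA v (by omega) le_rfl) (by simp)
  simp [this]

/-- A pull lifts the count of an arm to at least `1`. So after the last time at which `b` has count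
at least `1`, only arms of `S.erase b` are pulled; the window bound limits that period and hence the
decay of the count. If there is no such time, the whole window avoids `b`. -/
lemma WindowBound.persistence (hγ : 0 < γ) (hγ1 : γ ≤ 1) {t k : ℕ} {y : ℝ} (hy : 1 ≤ y)
    (hW : WindowBound γ A t k y) {u s : ℕ} {S : Finset (Fin K)} {b : Fin K} (hu : K ≤ u)
    (hus : u ≤ s) (hst : s ≤ t) (hS : (S.erase b).card ≤ k)
    (hA : ∀ q, u < q → q ≤ s → A q ∈ S) :
    γ ≤ discCount γ A s b * y ^ 2 ∨
      (1 ≤ γ ^ (s - u) * y ^ 2 ∧ discCount γ A s b = γ ^ (s - u) * discCount γ A u b) := by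
  classical
  by_cases h : ∃ p, u ≤ p ∧ p ≤ s ∧ 1 ≤ discCount γ A p b
  · left
    obtain ⟨p₀, hp₀⟩ := h
    set p := Nat.findGreatest (fun p => u ≤ p ∧ 1 ≤ discCount γ A p b) s with hp
    have hps : p ≤ s := Nat.findGreatest_le s
    have hpp : u ≤ p ∧ 1 ≤ discCount γ A p b :=
      Nat.findGreatest_spec (P := fun p => u ≤ p ∧ 1 ≤ discCount γ A p b) hp₀.2.1
        ⟨hp₀.1, hp₀.2.2⟩
    have hlt : ∀ q, p < q → q ≤ s → discCount γ A q b < 1 := by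
      intro q h1 h2
      have := Nat.findGreatest_is_greatest h1 h2
      push Not at this
      exact this (by omega)
    have hne : ∀ q, p < q → q ≤ s → A q ≠ b := by
      intro q h1 h2 h3
      obtain ⟨q, rfl⟩ : ∃ q', q = q' + 1 := ⟨q - 1, by omega⟩
      exact absurd (one_le_discCount_succ hγ.le h3) (not_le.2 (hlt _ h1 h2))
    have hN : discCount γ A s b = γ ^ (s - p) * discCount γ A p b :=
      discCount_eq_of_not_pulled hps hne
    have hNge : γ ^ (s - p) ≤ discCount γ A s b := by
      rw [hN]; exact le_mul_of_one_le_right (by positivity) hpp.2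
    have hy2 : 1 ≤ y ^ 2 := one_le_pow₀ hy
    rcases hps.eq_or_lt with hps | hps
    · rw [hps] at hNge
      simp only [tsub_self, pow_zero] at hNge
      nlinarith
    -- The window starts at `p + 1`, since the count has to be at most `1` at its left end; this
    -- costs one factor `γ`.
    · have := hW (p + 1) s (S.erase b) b (by omega) (by omega) hst hS
        (fun q h1 h2 => Finset.mem_erase.2 ⟨hne q (by omega) h2, hA q (by omega) h2⟩) (by simp)
        (hlt (p + 1) (by omega) (by omega)).le
      calc γ ≤ γ * (γ ^ (s - (p + 1)) * y ^ 2) := le_mul_of_one_le_right hγ.le this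
        _ = γ ^ (s - p) * y ^ 2 := by
            rw [show s - p = (s - (p + 1)) + 1 by omega]; ring
        _ ≤ _ := by gcongr
  · right
    push Not at h
    have hne : ∀ q, u < q → q ≤ s → A q ≠ b := by
      intro q h1 h2 h3
      obtain ⟨q, rfl⟩ : ∃ q', q = q' + 1 := ⟨q - 1, by omega⟩
      exact absurd (one_le_discCount_succ hγ.le h3) (not_le.2 (h _ (by omega) h2))
    refine ⟨?_, discCount_eq_of_not_pulled hus hne⟩
    exact hW u s (S.erase b) b hu hus hst hS
        (fun q h1 h2 => Finset.mem_erase.2 ⟨hne q (by omega) h2, hA q (by omega) h2⟩) (by simp)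
        (h u le_rfl hus).le

/-- Among any `K + 1` consecutive times some arm is pulled twice. -/
lemma exists_recent_pull (A : ℕ → Fin K) (v : ℕ) (hv : K < v) :
    ∃ s p, p < s ∧ s ≤ v ∧ v ≤ s + K ∧ s ≤ p + K ∧ v ≤ p + K ∧ A p = A s := by
  obtain ⟨x, hx, y, hy, hne, hxy⟩ := Finset.exists_ne_map_eq_of_card_lt_of_maps_to
    (s := Finset.Icc (v - K) v) (t := (Finset.univ : Finset (Fin K))) (f := A)
    (by simp; omega) (fun _ _ => by simp)
  rw [Finset.mem_Icc] at hx hy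
  rcases lt_or_gt_of_ne hne with h | h
  · exact ⟨y, x, h, by omega, by omega, by omega, by omega, hxy⟩
  · exact ⟨x, y, h, by omega, by omega, by omega, by omega, hxy.symm⟩

/-- Bound for the discounted feedback of an arm when large feedback can be received only in
rounds where the arm has a small discounted count. -/
lemma discSum_le_add_min (hγ : 0 < γ) (hγ1 : γ ≤ 1) {F G : ℝ} (hG : 0 ≤ G) {b : Fin K}
    {t : ℕ} (h1 : ∀ τ, τ < t → A (τ + 1) = b → 1 ≤ discCount γ A τ b → r (τ + 1) ≤ F)
    (h2 : ∀ τ, τ < t → A (τ + 1) = b → r (τ + 1) ≤ F + G) :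
    discSum γ A r t b ≤ F * discCount γ A t b + G * min (discCount γ A t b) 2 := by
  induction t with
  | zero => simp [discSum_zero, discCount_zero]
  | succ t ih =>
    have ih := ih (fun τ h => h1 τ (by omega)) (fun τ h => h2 τ (by omega))
    have hN : 0 ≤ discCount γ A t b := discCount_nonneg hγ.le
    rw [discSum_succ, discCount_succ]
    set N := discCount γ A t b
    have hm : γ * min N 2 ≤ min (γ * N) 2 := by
      rw [le_min_iff]
      constructor
      · gcongr; exact min_le_left _ _
      · calc γ * min N 2 ≤ 1 * min N 2 := by gcongr
          _ ≤ 2 := by rw [one_mul]; exact min_le_right _ _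
    have ih' : γ * discSum γ A r t b ≤ F * (γ * N) + G * (γ * min N 2) := by
      calc γ * discSum γ A r t b ≤ γ * (F * N + G * min N 2) := by gcongr
        _ = _ := by ring
    split_ifs with hA
    · by_cases hN1 : 1 ≤ N
      · have := h1 t (by omega) hA hN1
        have h3 : G * (γ * min N 2) ≤ G * min (γ * N + 1) 2 := by
          gcongr
          exact hm.trans (min_le_min_right _ (by linarith))
        linarith
      · push Not at hN1
        have := h2 t (by omega) hA
        -- A large feedback arrives at a count below `1`, so the count stays below `2` after the
        -- pull and the cap is not active; the excess therefore grows along with the count.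
        have h3 : min (γ * N + 1) 2 = γ * N + 1 := min_eq_left (by nlinarith)
        have h4 : G * (γ * min N 2) ≤ G * (γ * N) := by
          gcongr; exact min_le_left _ _
        rw [h3]
        linarith
    · have : G * (γ * min N 2) ≤ G * min (γ * N) 2 := by gcongr
      simpa using ih'.trans (by linarith)

/-- Feedback at most `R` creates no new excess over the level `R`, so an excess present at time `w`
only decays geometrically. -/
lemma discSum_le_add_pow (hγ : 0 ≤ γ) {R C : ℝ} {b : Fin K} {w t : ℕ} (hwt : w ≤ t)
    (h0 : discSum γ A r w b ≤ R * discCount γ A w b + C)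
    (h1 : ∀ τ, w ≤ τ → τ < t → A (τ + 1) = b → r (τ + 1) ≤ R) :
    discSum γ A r t b ≤ R * discCount γ A t b + C * γ ^ (t - w) := by
  induction t, hwt using Nat.le_induction with
  | base => simpa using h0
  | succ t hwt ih =>
    have ih := ih fun τ h h' => h1 τ h (by omega)
    have := mul_le_mul_of_nonneg_left ih hγ
    rw [discSum_succ, discCount_succ, show t + 1 - w = (t - w) + 1 by omega, pow_succ]
    split_ifs with hA
    · have := h1 t hwt (by omega) hA
      nlinarith
    · nlinarith

/-- The properties of a trajectory up to time `T` on which the lower bound for the discounted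
counts rests: the confidence radius is `ρ t / √N`, and large feedback can be received only from an
arm with small discounted count. -/
structure IsControlled (T : ℕ) (γ M : ℝ) (ρ : ℕ → ℝ) (A : ℕ → Fin K) (r : ℕ → ℝ) : Prop where
  mono : Monotone ρ
  pos : 0 < ρ K
  init : ∀ t, t < T → t < K → r (t + 1) ≤ M * ρ K
  feedback : ∀ t, t < T → K ≤ t → ∀ z : ℝ, 0 < z → z ≤ 1 → z ^ 2 ≤ discCount γ A t (A (t + 1)) →
    r (t + 1) ≤ M * ρ t / z
  ucb : ∀ t, t < T → K ≤ t → ∀ i, ρ t / √(discCount γ A t i) ≤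
    discMean γ A r t (A (t + 1)) + ρ t / √(discCount γ A t (A (t + 1)))

-- In a long window the neglected arm `a` has count of order `h ^ 2` with `h = √(γ ^ (v - u))`,
-- hence a radius of order at least `ρ / h`. Near its end some arm `b` is still preferred although
-- it was pulled recently, so the mean of `b` must be of order `ρ / h`. But late in the window the
-- count of `b` is at least of order `Y ^ (-2 * e)`, by the bound for one active arm less, which
-- gives feedback of order `ρ * Y ^ e`. Earlier, the a priori bound `hE` limits the feedback to
-- order `ρ * Y ^ E`; its excess is received only at counts below `1`, and is then discounted by
-- about `h ^ 2 * Y ^ (2 * e)`. So `1 / h` is at most of order `Y ^ e + Y ^ (2 * e + E) * h ^ 2`,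
-- impossible for `h < Y ^ (-e')` by the two conditions on the exponents.
set_option maxHeartbeats 1000000 in
lemma WindowBound.succ {γ₀ M Y : ℝ} {ρ : ℕ → ℝ} {T t k e e' E : ℕ} (hγ₀ : 0 < γ₀) (hγ : γ₀ ≤ γ)
    (hγ1 : γ ≤ 1) (hM : 1 ≤ M) (hY : 5 * M ≤ (γ₀ ^ (K + 3)) ^ 4 * Y)
    (hc : IsControlled T γ M ρ A r) (htT : t ≤ T)
    (hE : ∀ s, K ≤ s → s < t → ∀ i, 1 ≤ discCount γ A s i * (Y ^ E) ^ 2)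
    (hee : e + 1 ≤ e') (heE : 2 * e + E + 1 ≤ 3 * e') (hW : WindowBound γ A t k (Y ^ e)) :
    WindowBound γ A t (k + 1) (Y ^ e') := by
  intro u v S a hu huv hv hS hA ha hNa
  by_contra! hlt
  have hγ0 : 0 < γ := hγ₀.trans_le hγ
  have hγ₀1 : γ₀ ≤ 1 := hγ.trans hγ1
  set q := γ₀ ^ (K + 3) with hq
  have hq0 : 0 < q := by positivity
  have hq1 : q ≤ 1 := pow_le_one₀ hγ₀.le hγ₀1
  have hqγ₀ : q ≤ γ₀ := pow_le_of_le_one hγ₀.le hγ₀1 (by omega)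
  have hpow : ∀ n, n ≤ K + 3 → q ≤ γ ^ n := fun n hn =>
    (pow_le_pow_of_le_one hγ₀.le hγ₀1 hn).trans (pow_le_pow_left₀ hγ₀.le hγ n)
  clear_value q
  have hq4 : q ^ 4 ≤ q := pow_le_of_le_one hq0.le hq1 (by norm_num)
  have hY0 : 0 < Y := by
    by_contra! h
    linarith [mul_nonneg (pow_pos hq0 4).le (neg_nonneg.2 h)]
  have hqY : 5 ≤ q * Y := by linarith [mul_le_mul_of_nonneg_right hq4 hY0.le]
  have hY5 : 5 ≤ Y := hqY.trans (mul_le_of_le_one_left hY0.le hq1)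
  have hY1 : 1 ≤ Y := by linarith
  set h := √(γ ^ (v - u)) with hh
  have hh0 : 0 < h := Real.sqrt_pos.2 (by positivity)
  have hh2 : h ^ 2 = γ ^ (v - u) := Real.sq_sqrt (by positivity)
  clear_value h
  have hhY' : h * Y ^ e' < 1 := by
    rw [← hh2, ← mul_pow] at hlt
    exact lt_of_pow_lt_pow_left₀ 2 zero_le_one (by simpa using hlt)
  have hhYe : h * Y ^ e * Y ≤ 1 := by
    calc h * Y ^ e * Y = h * Y ^ (e + 1) := by ring
      _ ≤ h * Y ^ e' := by gcongr
      _ ≤ 1 := hhY'.le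
  have hYe1 : 1 ≤ Y ^ e := one_le_pow₀ hY1
  have hYE1 : 1 ≤ Y ^ E := one_le_pow₀ hY1
  have hhY : h * Y ≤ 1 := by
    calc h * Y ≤ h * Y ^ e * Y := by
          gcongr; exact le_mul_of_one_le_right hh0.le hYe1
      _ ≤ 1 := hhYe
  have hhq : h ≤ q := by
    by_contra! hcon
    linarith [mul_lt_mul_of_pos_right hcon hY0]
  have hh1 : h ≤ 1 := hhq.trans hq1
  have hh2q : h ^ 2 < q := by
    have h1 : h < 1 := by
      by_contra! hcon
      linarith [mul_le_mul_of_nonneg_right hcon hY0.le]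
    calc h ^ 2 = h * h := sq h
      _ < 1 * h := mul_lt_mul_of_pos_right h1 hh0
      _ ≤ q := by linarith
  -- The window is longer than `K + 3`, so the two pulls of the same arm found among the last `K +
  -- 1` times lie inside it.
  have hvu : K + 3 < v - u := by
    by_contra! hcon
    linarith [hpow _ hcon]
  obtain ⟨s, p, hps, hsv, hvs, hsp, hvp, hAp⟩ := exists_recent_pull A v (by omega)
  obtain ⟨σ, rfl⟩ : ∃ σ, s = σ + 1 := ⟨s - 1, by omega⟩
  set b := A (σ + 1) with hb
  have hσt : σ < t := by omega
  have hKσ : K ≤ σ := by omega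
  have hρK : 0 < ρ σ := hc.pos.trans_le (hc.mono hKσ)
  have hNb : q ≤ discCount γ A σ b :=
    (hpow (σ - p) (by omega)).trans (pow_le_discCount hγ0.le (by omega) (by omega) hAp)
  have hNaσ : discCount γ A σ a ≤ γ ^ (σ - u) := by
    rw [discCount_eq_of_not_pulled (u := u) (v := σ) (by omega)
      (fun s h1 h2 h3 => ha (by rw [← h3]; exact hA s h1 (by omega)))]
    exact mul_le_of_le_one_right (by positivity) hNa
  have hqσ : q * γ ^ (σ - u) ≤ h ^ 2 := by
    calc q * γ ^ (σ - u) ≤ γ ^ (v - σ) * γ ^ (σ - u) := by gcongr; exact hpow _ (by omega)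
      _ = h ^ 2 := by rw [hh2, ← pow_add]; congr 1; omega
  have hbS : b ∈ S := hA _ (by omega) hsv
  -- The last time until which a window from `u` may avoid `b` under the bound for `k` arms; beyond
  -- `w` the first alternative of `persistence` must hold.
  set w := Nat.findGreatest (fun w => u ≤ w ∧ 1 ≤ γ ^ (w - u) * (Y ^ e) ^ 2) σ with hw
  have hwσ : w ≤ σ := Nat.findGreatest_le σ
  have hwP : u ≤ w ∧ 1 ≤ γ ^ (w - u) * (Y ^ e) ^ 2 :=
    Nat.findGreatest_spec (P := fun w => u ≤ w ∧ 1 ≤ γ ^ (w - u) * (Y ^ e) ^ 2)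
      (m := u) (by omega) ⟨le_rfl, by simpa using one_le_pow₀ (n := 2) hYe1⟩
  have hwlt : ∀ τ, w < τ → τ ≤ σ → γ ^ (τ - u) * (Y ^ e) ^ 2 < 1 := by
    intro τ h1 h2
    have := Nat.findGreatest_is_greatest h1 h2
    push Not at this
    exact this (by omega)
  clear_value w
  have hwσ' : w < σ := by
    refine lt_of_le_of_ne hwσ fun hcon => ?_
    have h1 : 1 ≤ γ ^ (σ - u) * (Y ^ e) ^ 2 := hcon ▸ hwP.2
    have h2 : q ≤ (h * Y ^ e) ^ 2 := by
      calc q ≤ q * (γ ^ (σ - u) * (Y ^ e) ^ 2) := le_mul_of_one_le_right hq0.le h1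
        _ = q * γ ^ (σ - u) * (Y ^ e) ^ 2 := by ring
        _ ≤ h ^ 2 * (Y ^ e) ^ 2 := by gcongr
        _ = _ := by ring
    have h3 : (h * Y ^ e) ^ 2 * Y ≤ 1 / Y := by
      rw [le_div_iff₀ hY0]
      calc (h * Y ^ e) ^ 2 * Y * Y = (h * Y ^ e * Y) ^ 2 := by ring
        _ ≤ 1 := pow_le_one₀ (by positivity) hhYe
    have h4 : q * Y ≤ 1 / Y := (mul_le_mul_of_nonneg_right h2 hY0.le).trans h3
    have : 1 / Y ≤ 1 / 5 := by gcongr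
    linarith
  have hSk : (S.erase b).card ≤ k := by rw [Finset.card_erase_of_mem hbS]; omega
  have hNτ : ∀ τ, w < τ → τ ≤ σ → γ ≤ discCount γ A τ b * (Y ^ e) ^ 2 := by
    intro τ h1 h2
    rcases hW.persistence hγ0 hγ1 hYe1 hu (s := τ) (by omega) (by omega) hSk
      (fun q h1 h2 => hA q h1 (by omega)) with h3 | h3
    · exact h3
    · exact absurd h3.1 (not_le.2 (hwlt τ h1 h2))
  -- `R` bounds the feedback of `b` after `w`; `G` bounds the excess feedback before it.
  set R := M * ρ σ * Y ^ e / q with hR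
  set G := M * ρ σ * Y ^ E with hG
  have hM0 : 0 < M := by linarith
  have hMρ : 0 < M * ρ σ := by positivity
  have hFR : M * ρ σ ≤ R := by
    rw [hR, le_div_iff₀ hq0]
    exact mul_le_mul_of_nonneg_left (hq1.trans hYe1) hMρ.le
  have hmono : ∀ τ, τ ≤ σ → M * ρ τ ≤ M * ρ σ := fun τ hτ => by gcongr; exact hc.mono hτ
  have hG0 : 0 ≤ G := by positivity
  clear_value R G
  have hold : discSum γ A r (w + 1) b ≤ R * discCount γ A (w + 1) b + 2 * G := by
    have := discSum_le_add_min (r := r) (A := A) (b := b) (t := w + 1) hγ0 hγ1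
      (F := M * ρ σ) hG0 ?_ ?_
    · calc discSum γ A r (w + 1) b ≤ _ := this
        _ ≤ R * discCount γ A (w + 1) b + G * 2 := by
          gcongr
          · exact discCount_nonneg hγ0.le
          · exact min_le_right _ _
        _ = _ := by ring
    · intro τ h1 h2 h3
      by_cases hτ : τ < K
      · exact (hc.init τ (by omega) hτ).trans (hmono K hKσ)
      · have := hc.feedback τ (by omega) (by omega) 1 one_pos le_rfl (by simpa [h2] using h3)
        exact (by simpa using this : _ ≤ M * ρ τ).trans (hmono τ (by omega))
    · intro τ h1 h2
      by_cases hτ : τ < K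
      · linarith [hc.init τ (by omega) hτ, hmono K hKσ]
      · have h3 := hE τ (by omega) (by omega) b
        have := hc.feedback τ (by omega) (by omega) (1 / Y ^ E) (by positivity)
          (by rw [div_le_one (by positivity)]; exact hYE1)
          (by rw [h2, div_pow, one_pow, div_le_iff₀ (by positivity)]; exact h3)
        rw [div_div_eq_mul_div, div_one] at this
        have : M * ρ τ * Y ^ E ≤ G := by
          rw [hG]; gcongr; exact hc.mono (by omega)
        linarith
  have hsum : discSum γ A r σ b ≤ R * discCount γ A σ b + 2 * G * γ ^ (σ - (w + 1)) := by
    refine discSum_le_add_pow hγ0.le (by omega) hold fun τ h1 h2 h3 => ?_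
    have h4 := hNτ τ (by omega) (by omega)
    have := hc.feedback τ (by omega) (by omega) (γ₀ / Y ^ e) (by positivity)
      (by rw [div_le_one (by positivity)]; linarith)
      (by
        rw [h3, div_pow, div_le_iff₀ (by positivity)]
        exact ((pow_le_of_le_one hγ₀.le hγ₀1 two_ne_zero).trans hγ).trans h4)
    rw [div_div_eq_mul_div] at this
    refine this.trans ?_
    rw [hR]
    gcongr
    exact hc.mono (by omega)
  set P := γ ^ (σ - (w + 1)) with hP
  have hP0 : 0 < P := by positivity
  -- By maximality in the choice of `w`, `γ ^ (w - u)` is at least `Y ^ (-2 * e)`, so the discount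
  -- from `w + 1` to `σ` is nearly that of the whole window times `Y ^ (2 * e)`. The factors `q`
  -- absorb the offsets at the ends.
  have hPq : P * q ^ 2 ≤ h ^ 2 * (Y ^ e) ^ 2 := by
    calc P * q ^ 2 ≤ P * q ^ 2 * (γ ^ (w - u) * (Y ^ e) ^ 2) :=
          le_mul_of_one_le_right (by positivity) hwP.2
      _ = q * (P * q * γ ^ (w - u)) * (Y ^ e) ^ 2 := by ring
      _ ≤ q * (P * γ * γ ^ (w - u)) * (Y ^ e) ^ 2 := by gcongr; linarith
      _ = q * γ ^ (σ - u) * (Y ^ e) ^ 2 := by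
          rw [hP, ← pow_succ, ← pow_add]
          congr 3
          omega
      _ ≤ _ := by gcongr
  clear_value P b
  have hNb0 : 0 < discCount γ A σ b := hq0.trans_le hNb
  have hmean : discMean γ A r σ b ≤ R + 2 * G * P / q := by
    rw [discMean_eq, div_le_iff₀ hNb0, add_mul]
    refine hsum.trans (add_le_add_right ?_ _)
    rw [div_mul_eq_mul_div, le_div_iff₀ hq0]
    gcongr
  have hNa0 : 0 < discCount γ A σ a := by
    by_contra! hcon
    linarith [hE σ hKσ hσt a, mul_nonneg (neg_nonneg.2 hcon) (sq_nonneg (Y ^ E))]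
  have hucb := hc.ucb σ (by omega) hKσ a
  rw [← hb] at hucb
  have hra : ρ σ * q / h ≤ ρ σ / √(discCount γ A σ a) := by
    have : √(discCount γ A σ a) ≤ h / q := by
      rw [Real.sqrt_le_left (by positivity), div_pow, le_div_iff₀ (by positivity)]
      calc discCount γ A σ a * q ^ 2 ≤ γ ^ (σ - u) * q := by
            gcongr
            exact pow_le_of_le_one hq0.le hq1 two_ne_zero
        _ ≤ h ^ 2 := by linarith
    calc ρ σ * q / h = ρ σ / (h / q) := by field_simp
      _ ≤ _ := by gcongr
  have hrb : ρ σ / √(discCount γ A σ b) ≤ ρ σ / q := by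
    gcongr
    exact Real.le_sqrt_of_sq_le ((pow_le_of_le_one hq0.le hq1 two_ne_zero).trans hNb)
  have hmain : ρ σ * q / h ≤ M * ρ σ * Y ^ e / q + 2 * (M * ρ σ * Y ^ E) * P / q + ρ σ / q := by
    rw [← hR, ← hG]
    linarith
  have hmain2 : q ^ 4 ≤ h * q ^ 2 * (M * Y ^ e + 1) + 2 * M * Y ^ E * h * (P * q ^ 2) := by
    have h1 : ρ σ * q / h * (h * q ^ 3 / ρ σ) ≤ (M * ρ σ * Y ^ e / q +
      2 * (M * ρ σ * Y ^ E) * P / q + ρ σ / q) * (h * q ^ 3 / ρ σ) := by gcongr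
    have h2 : ρ σ * q / h * (h * q ^ 3 / ρ σ) = q ^ 4 := by field_simp
    have h3 : (M * ρ σ * Y ^ e / q + 2 * (M * ρ σ * Y ^ E) * P / q + ρ σ / q) *
      (h * q ^ 3 / ρ σ) = h * q ^ 2 * (M * Y ^ e + 1) + 2 * M * Y ^ E * h * (P * q ^ 2) := by
      field_simp
      ring
    rwa [h2, h3] at h1
  -- This is where `2 * e + E + 1 ≤ 3 * e'` enters: three powers of `h` pay for the early feedback,
  -- with one spare factor `Y`.
  have hYcube : Y ^ E * h * (h ^ 2 * (Y ^ e) ^ 2) * Y ≤ 1 := by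
    calc Y ^ E * h * (h ^ 2 * (Y ^ e) ^ 2) * Y = h ^ 3 * Y ^ (2 * e + E + 1) := by ring
      _ ≤ h ^ 3 * Y ^ (3 * e') := by gcongr
      _ = (h * Y ^ e') ^ 3 := by ring
      _ ≤ 1 := pow_le_one₀ (by positivity) hhY'.le
  have hfin : q ^ 4 * Y ≤ 4 * M := by
    calc q ^ 4 * Y ≤ (h * q ^ 2 * (M * Y ^ e + 1) + 2 * M * Y ^ E * h * (P * q ^ 2)) * Y := by
          gcongr
      _ ≤ (h * 1 * (M * Y ^ e + 1) + 2 * M * Y ^ E * h * (h ^ 2 * (Y ^ e) ^ 2)) * Y := by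
          gcongr
          exact pow_le_one₀ hq0.le hq1
      _ = M * (h * Y ^ e * Y) + h * Y + 2 * M * (Y ^ E * h * (h ^ 2 * (Y ^ e) ^ 2) * Y) := by
          ring
      _ ≤ M * 1 + 1 + 2 * M * 1 := by gcongr
      _ ≤ 4 * M := by linarith
  linarith

/-- The discounted counts are bounded below by a positive constant after the initialization. -/
lemma IsControlled.one_le_discCount_mul {γ₀ M Y : ℝ} {ρ : ℕ → ℝ} {T : ℕ} (hγ₀ : 0 < γ₀)
    (hγ : γ₀ ≤ γ) (hγ1 : γ ≤ 1) (hM : 1 ≤ M) (hY : 5 * M ≤ (γ₀ ^ (K + 3)) ^ 4 * Y)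
    (hc : IsControlled T γ M ρ A r) (hA : ∀ t, t < T → t < K → (A (t + 1) : ℕ) = t) :
    ∀ t, K ≤ t → t ≤ T → ∀ i, 1 ≤ discCount γ A t i * (Y ^ 2 ^ K) ^ 2 := by
  intro t
  induction t using Nat.strong_induction_on with
  | _ t ih =>
  intro hKt htT i
  have hK : 0 < K := i.pos
  have hγ₀1 : γ₀ ≤ 1 := hγ.trans hγ1
  have hγ0 : 0 < γ := hγ₀.trans_le hγ
  set q := γ₀ ^ (K + 3) with hq
  have hq0 : 0 < q := by positivity
  have hq1 : q ≤ 1 := pow_le_one₀ hγ₀.le hγ₀1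
  have hq4 : q ^ 4 ≤ q := pow_le_of_le_one hq0.le hq1 (by norm_num)
  have hY0 : 0 < Y := by
    by_contra! h
    linarith [mul_nonneg (pow_pos hq0 4).le (neg_nonneg.2 h)]
  have hqY : 5 ≤ q * Y := by linarith [mul_le_mul_of_nonneg_right hq4 hY0.le]
  have hY1 : 1 ≤ Y := by linarith [mul_le_of_le_one_left hY0.le hq1]
  -- The exponents `2 ^ K - 2 ^ (K - k)` satisfy both conditions of `WindowBound.succ` with `E = 2 ^
  -- K` and stay strictly below `E`, so the bound known at earlier times reproduces itself at time
  -- `t`.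
  have hW : ∀ k, k < K → WindowBound γ A t k (Y ^ (2 ^ K - 2 ^ (K - k))) := by
    intro k
    induction k with
    | zero => intro _; simpa using windowBound_zero t
    | succ k ihk =>
      intro hk
      have h1 : 2 ^ (K - k) = 2 * 2 ^ (K - (k + 1)) := by
        rw [← pow_succ']; congr 1; omega
      have h2 : 2 ^ (K - k) ≤ 2 ^ K := Nat.pow_le_pow_right (by norm_num) (by omega)
      have h3 : 0 < 2 ^ (K - (k + 1)) := by positivity
      refine WindowBound.succ hγ₀ hγ hγ1 hM hY hc htT (E := 2 ^ K)
        (fun s h1 h2 => ih s h2 h1 (by omega)) ?_ ?_ (ihk (by omega)) <;> omega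
  have hW := hW (K - 1) (by omega)
  have hK2 : 2 ≤ 2 ^ K := by
    calc 2 = 2 ^ 1 := rfl
      _ ≤ 2 ^ K := Nat.pow_le_pow_right (by norm_num) hK
  rw [show K - (K - 1) = 1 by omega, pow_one] at hW
  -- At `k = K - 1` the exponent is `2 ^ K - 2`; the spare factor `Y ^ 4` absorbs the loss `q`.
  have hexp : (Y ^ 2 ^ K) ^ 2 = (Y ^ (2 ^ K - 2)) ^ 2 * Y ^ 4 := by
    rw [← pow_mul, ← pow_mul, ← pow_add]
    congr 1
    omega
  have hY4 : 1 ≤ q * Y ^ 4 := by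
    have : Y ≤ Y ^ 4 := le_self_pow₀ hY1 (by norm_num)
    nlinarith
  have hN0 : 0 ≤ discCount γ A t i := discCount_nonneg hγ0.le
  rw [hexp]
  rcases hW.persistence hγ0 hγ1 (one_le_pow₀ hY1) (u := K) (s := t) (S := Finset.univ) (b := i)
    le_rfl hKt le_rfl (by simp) (by simp) with h | ⟨h, hN⟩
  · have hqγ : q ≤ γ := (pow_le_of_le_one hγ₀.le hγ₀1 (by omega)).trans hγ
    calc 1 ≤ γ * Y ^ 4 := hY4.trans (by gcongr)
      _ ≤ discCount γ A t i * (Y ^ (2 ^ K - 2)) ^ 2 * Y ^ 4 := by gcongr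
      _ = _ := by ring
  · have hNK : q ≤ discCount γ A K i := by
      have := pow_le_discCount (A := A) (i := i) hγ0.le (p := i + 1) (t := K) (by omega)
        (by omega) (Fin.ext (hA i (by omega) i.isLt))
      refine le_trans ?_ this
      calc q ≤ γ₀ ^ (K - (i + 1)) := pow_le_pow_of_le_one hγ₀.le hγ₀1 (by omega)
        _ ≤ _ := pow_le_pow_left₀ hγ₀.le hγ _
    calc 1 ≤ 1 * (q * Y ^ 4) := by rw [one_mul]; exact hY4
      _ ≤ γ ^ (t - K) * (Y ^ (2 ^ K - 2)) ^ 2 * (discCount γ A K i * Y ^ 4) := by gcongr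
      _ = _ := by rw [hN]; ring

end LowerBound

/-! ### Deterministic bounds along one trajectory: compensation, drift, number of pulls. -/

section Trajectory

variable {K T : ℕ} {ξ γ : ℝ} {l : ℝ≥0} {f : ℕ → ℝ → ℝ} {x : ℕ → Fin K → ℝ} {A g : ℕ → Fin K}
  {r : ℕ → ℝ} {t : ℕ}

/-- The numerator `2 √(ξ log n_t(γ))` of the confidence radius. -/
def radiusScale (ξ γ : ℝ) (A : ℕ → Fin K) (t : ℕ) : ℝ := 2 * √(ξ * Real.log (discTotal γ A t))

lemma discRadius_eq (hγ : 0 ≤ γ) (t : ℕ) (i : Fin K) :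
    discRadius ξ γ A t i = radiusScale ξ γ A t / √(discCount γ A t i) := by
  rw [discRadius, radiusScale, Real.sqrt_div', mul_div_assoc]
  exact discCount_nonneg hγ

lemma log_discTotal_nonneg (hγ : 0 ≤ γ) (t : ℕ) : 0 ≤ Real.log (discTotal γ A t) := by
  rcases Nat.eq_zero_or_pos t with rfl | ht
  · simp [discTotal_zero]
  · exact Real.log_nonneg (one_le_discTotal hγ ht)

lemma log_discTotal_mono (hγ : 0 ≤ γ) : Monotone fun t => Real.log (discTotal γ A t) := by
  intro s t hst
  rcases Nat.eq_zero_or_pos s with rfl | hs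
  · simpa [discTotal_zero] using log_discTotal_nonneg hγ t
  · exact Real.log_le_log (by linarith [one_le_discTotal (A := A) hγ hs]) (discTotal_mono hγ hst)

lemma log_discTotal_le (hγ : 0 ≤ γ) (hγ1 : γ ≤ 1) (htT : t ≤ T) :
    Real.log (discTotal γ A t) ≤ Real.log T := by
  rcases Nat.eq_zero_or_pos t with rfl | ht
  · simpa [discTotal_zero] using Real.log_natCast_nonneg T
  · refine Real.log_le_log (by linarith [one_le_discTotal (A := A) hγ ht]) ?_
    exact (discTotal_le hγ hγ1).trans (by exact_mod_cast htT)

lemma radiusScale_mono (hγ : 0 ≤ γ) (hξ : 0 ≤ ξ) : Monotone (radiusScale ξ γ A) := by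
  intro s t hst
  unfold radiusScale
  have := log_discTotal_mono (A := A) hγ hst
  dsimp only at this
  apply mul_le_mul_of_nonneg_left _ zero_le_two
  exact Real.sqrt_le_sqrt (mul_le_mul_of_nonneg_left this hξ)

lemma radiusScale_nonneg : 0 ≤ radiusScale ξ γ A t := by unfold radiusScale; positivity

lemma radiusScale_le (hγ : 0 ≤ γ) (hγ1 : γ ≤ 1) (hξ : 0 ≤ ξ) (htT : t ≤ T) :
    radiusScale ξ γ A t ≤ 2 * √ξ * √(Real.log T) := by
  rw [mul_assoc, ← Real.sqrt_mul hξ, radiusScale]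
  apply mul_le_mul_of_nonneg_left _ zero_le_two
  exact Real.sqrt_le_sqrt (mul_le_mul_of_nonneg_left (log_discTotal_le hγ hγ1 htT) hξ)

/-- Since `n_2(γ) = 1 + γ`, the scale stays away from `0` from time `2` on, so additive constants
can be absorbed into multiples of it. -/
lemma radiusScale_ge {γ₀ : ℝ} (hγ₀ : 0 ≤ γ₀) (hγ : γ₀ ≤ γ) (hξ : 0 ≤ ξ) (ht : 2 ≤ t) :
    2 * √(ξ * Real.log (1 + γ₀)) ≤ radiusScale ξ γ A t := by
  have hγ0 := hγ₀.trans hγ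
  unfold radiusScale
  gcongr
  calc 1 + γ₀ ≤ discTotal γ A 2 := by rw [discTotal_eq_sum]; simp [Finset.sum_range_succ, hγ]
    _ ≤ _ := discTotal_mono hγ0 ht

namespace IsIncentivizedRun

lemma compensation_nonneg (hR : IsIncentivizedRun T γ f x A g r) (ht : t < T) :
    0 ≤ compensation γ A g r t := sub_nonneg.2 (hR.greedy t ht _)

lemma feedback_eq (hR : IsIncentivizedRun T γ f x A g r) (hf : IsDrift T l f) (ht : t < T) :
    r (t + 1) = x (t + 1) (A (t + 1)) + f (t + 1) (compensation γ A g r t) := by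
  by_cases h : A (t + 1) = g (t + 1)
  · rw [hR.feedback_of_eq t ht h, compensation, h, sub_self,
      hf.zero (t + 1) (Finset.mem_Icc.2 ⟨by omega, by omega⟩), add_zero]
  · exact hR.feedback_of_ne t ht h

lemma drift_nonneg (hR : IsIncentivizedRun T γ f x A g r) (hf : IsDrift T l f) (ht : t < T) :
    0 ≤ f (t + 1) (compensation γ A g r t) := by
  have hm : t + 1 ∈ Finset.Icc 1 T := Finset.mem_Icc.2 ⟨by omega, by omega⟩
  rw [← hf.zero (t + 1) hm]
  exact hf.mono _ hm (hR.compensation_nonneg ht)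

lemma drift_le (hR : IsIncentivizedRun T γ f x A g r) (hf : IsDrift T l f) (ht : t < T) :
    f (t + 1) (compensation γ A g r t) ≤ l * compensation γ A g r t := by
  have hm : t + 1 ∈ Finset.Icc 1 T := Finset.mem_Icc.2 ⟨by omega, by omega⟩
  have := (hf.lipschitz _ hm).dist_le_mul (compensation γ A g r t) 0
  rw [hf.zero (t + 1) hm, dist_zero_right, dist_zero_right, Real.norm_eq_abs, Real.norm_eq_abs,
    abs_of_nonneg (hR.compensation_nonneg ht)] at this
  exact (le_abs_self _).trans this

variable (hR : IsIncentivizedRun T γ f x A g r) (hf : IsDrift T l f)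
  (hx : ∀ t, t < T → ∀ i, x (t + 1) i ∈ Set.Icc (0 : ℝ) 1)

include hR hf hx in
lemma feedback_nonneg (s : ℕ) (h1 : 1 ≤ s) (hs : s ≤ T) : 0 ≤ r s := by
  obtain ⟨s, rfl⟩ : ∃ s', s = s' + 1 := ⟨s - 1, by omega⟩
  rw [hR.feedback_eq hf (by omega)]
  exact add_nonneg (hx s (by omega) _).1 (hR.drift_nonneg hf (by omega))

include hR hf hx in
lemma feedback_le (ht : t < T) : r (t + 1) ≤ 1 + l * compensation γ A g r t := by
  rw [hR.feedback_eq hf ht]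
  exact add_le_add (hx t ht _).2 (hR.drift_le hf ht)

include hR hf hx in
lemma compensation_le_of_feedback_le (hγ : 0 ≤ γ) {B : ℝ} (hB : 0 ≤ B) (ht : t < T)
    (h : ∀ s, 1 ≤ s → s ≤ t → r s ≤ B) : compensation γ A g r t ≤ B := by
  have h1 : discMean γ A r t (g (t + 1)) ≤ B := discMean_le hγ hB h
  have h2 : 0 ≤ discMean γ A r t (A (t + 1)) :=
    discMean_nonneg hγ fun s h1 h2 => hR.feedback_nonneg hf hx s h1 (by omega)
  unfold compensation
  linarith

-- Means never exceed the largest past feedback, so each round multiplies the bound by at most `1 +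
-- l`. This crude growth serves to control the initialization.
include hR hf hx in
lemma feedback_le_pow (hγ : 0 ≤ γ) (ht : t ≤ T) :
    ∀ s, 1 ≤ s → s ≤ t → r s ≤ (1 + (l : ℝ)) ^ t := by
  have hl : (0 : ℝ) ≤ l := l.2
  have h1 : (1 : ℝ) ≤ 1 + l := by linarith
  induction t with
  | zero => intro s h1 h2; omega
  | succ t ih =>
    have ih := ih (by omega)
    intro s hs1 hs2
    rcases Nat.lt_or_ge s (t + 1) with hs | hs
    · exact (ih s hs1 (by omega)).trans (pow_le_pow_right₀ h1 (by omega))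
    · obtain rfl : s = t + 1 := by omega
      have hc := hR.compensation_le_of_feedback_le hf hx hγ (B := (1 + (l : ℝ)) ^ t)
        (by positivity) (by omega) ih
      calc r (t + 1) ≤ 1 + l * compensation γ A g r t := hR.feedback_le hf hx (by omega)
        _ ≤ (1 + (l : ℝ)) ^ t + l * (1 + (l : ℝ)) ^ t := by
            gcongr
            exact one_le_pow₀ h1
        _ = _ := by ring

include hR hf hx in
lemma compensation_le_pow (hγ : 0 ≤ γ) (ht : t < T) :
    compensation γ A g r t ≤ (1 + (l : ℝ)) ^ t :=
  hR.compensation_le_of_feedback_le hf hx hγ (by positivity) ht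
    (hR.feedback_le_pow hf hx hγ ht.le)

end IsIncentivizedRun

lemma IsDUCB.compensation_le_sub (hD : IsDUCB T ξ γ A r) (ht : t < T) (hKt : K ≤ t) :
    compensation γ A g r t ≤ discRadius ξ γ A t (A (t + 1)) - discRadius ξ γ A t (g (t + 1)) := by
  have := hD.argmax t ht hKt (g (t + 1))
  unfold discUCB at this
  unfold compensation
  linarith

lemma IsDUCB.compensation_le (hD : IsDUCB T ξ γ A r) (hγ : 0 ≤ γ) (ht : t < T)
    (hKt : K ≤ t) :
    compensation γ A g r t ≤ radiusScale ξ γ A t / √(discCount γ A t (A (t + 1))) := by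
  rw [← discRadius_eq hγ]
  have : 0 ≤ discRadius ξ γ A t (g (t + 1)) := by unfold discRadius; positivity
  linarith [hD.compensation_le_sub (g := g) ht hKt]

/-- Constant in the control of the feedback by the confidence radius. -/
def feedbackConst (K : ℕ) (ξ : ℝ) (l : ℝ≥0) (γ₀ : ℝ) : ℝ :=
  1 + l + (1 + (l : ℝ)) ^ K / (2 * √(ξ * Real.log (1 + γ₀)))

/-- Feedback is at most `1 + l` times the compensation in its drift part only, and the UCB rule
bounds the compensation by the radius of the pulled arm; the constant `1` and the initial feedback
are absorbed into the scale, which needs `K ≥ 2`. The UCB inequality survives without the mean on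
its left, because means are nonnegative. -/
lemma isControlled {γ₀ : ℝ} (hK : 2 ≤ K) (hγ₀ : 0 < γ₀) (hγ : γ₀ ≤ γ) (hξ : 0 < ξ)
    (hD : IsDUCB T ξ γ A r) (hR : IsIncentivizedRun T γ f x A g r) (hf : IsDrift T l f)
    (hx : ∀ t, t < T → ∀ i, x (t + 1) i ∈ Set.Icc (0 : ℝ) 1) :
    IsControlled T γ (feedbackConst K ξ l γ₀) (radiusScale ξ γ A) A r := by
  have hγ0 : 0 ≤ γ := hγ₀.le.trans hγ
  have hl : (0 : ℝ) ≤ l := l.2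
  have hl1 : 1 ≤ 1 + (l : ℝ) := by linarith
  have hlog : 0 < Real.log (1 + γ₀) := Real.log_pos (by linarith)
  set ρ₀ := 2 * √(ξ * Real.log (1 + γ₀)) with hρ₀
  have hρ₀0 : 0 < ρ₀ := by positivity
  have hρ : ∀ t, 2 ≤ t → ρ₀ ≤ radiusScale ξ γ A t := fun t ht => radiusScale_ge hγ₀.le hγ hξ.le ht
  have hM : ∀ t, 2 ≤ t → (1 + l) * radiusScale ξ γ A t + (1 + (l : ℝ)) ^ K ≤
      feedbackConst K ξ l γ₀ * radiusScale ξ γ A t := by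
    intro t ht
    rw [feedbackConst, ← hρ₀, add_mul _ (_ / _), div_mul_eq_mul_div]
    gcongr
    rw [le_div_iff₀ hρ₀0]
    gcongr
    exact hρ t ht
  refine ⟨radiusScale_mono hγ0 hξ.le, hρ₀0.trans_le (hρ K hK), ?_, ?_, ?_⟩
  · intro t ht htK
    calc r (t + 1) ≤ (1 + (l : ℝ)) ^ (t + 1) :=
          hR.feedback_le_pow hf hx hγ0 ht (t + 1) (by omega) le_rfl
      _ ≤ (1 + (l : ℝ)) ^ K := pow_le_pow_right₀ hl1 htK
      _ ≤ _ := by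
          have := hM K hK
          have : 0 ≤ (1 + l) * radiusScale ξ γ A K :=
            mul_nonneg (by positivity) radiusScale_nonneg
          linarith
  · intro t ht hKt z hz hz1 hzN
    rw [le_div_iff₀ hz]
    have h0 : z ≤ √(discCount γ A t (A (t + 1))) := Real.le_sqrt_of_sq_le hzN
    have hρ0 : 0 ≤ radiusScale ξ γ A t := radiusScale_nonneg
    have h1 : compensation γ A g r t ≤ radiusScale ξ γ A t / z :=
      (hD.compensation_le hγ0 ht hKt).trans (by gcongr)
    have h2 : compensation γ A g r t * z ≤ radiusScale ξ γ A t := by rwa [le_div_iff₀ hz] at h1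
    have h3 := hR.feedback_le hf hx ht
    have h4 := hM t (by omega)
    have h5 : (1 : ℝ) ≤ (1 + (l : ℝ)) ^ K := one_le_pow₀ hl1
    calc r (t + 1) * z ≤ (1 + l * compensation γ A g r t) * z := by gcongr
      _ = z + l * (compensation γ A g r t * z) := by ring
      _ ≤ 1 + l * radiusScale ξ γ A t := by gcongr
      _ ≤ _ := by linarith
  · intro t ht hKt i
    have h1 := hD.argmax t ht hKt i
    unfold discUCB at h1
    rw [discRadius_eq hγ0, discRadius_eq hγ0] at h1
    have h2 : 0 ≤ discMean γ A r t i :=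
      discMean_nonneg hγ0 fun s h1 h2 => hR.feedback_nonneg hf hx s h1 (by omega)
    linarith

/-- Lower bound for the discounted counts after the initialization. -/
def countConst (K : ℕ) (ξ : ℝ) (l : ℝ≥0) (γ₀ : ℝ) : ℝ :=
  1 / ((5 * feedbackConst K ξ l γ₀ / (γ₀ ^ (K + 3)) ^ 4) ^ 2 ^ K) ^ 2

lemma one_le_feedbackConst {γ₀ : ℝ} : 1 ≤ feedbackConst K ξ l γ₀ := by
  have hl : (0 : ℝ) ≤ l := l.2
  have : 0 ≤ (1 + (l : ℝ)) ^ K / (2 * √(ξ * Real.log (1 + γ₀))) := by positivity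
  unfold feedbackConst
  linarith

lemma countConst_pos {γ₀ : ℝ} (hγ₀ : 0 < γ₀) : 0 < countConst K ξ l γ₀ := by
  have := one_le_feedbackConst (K := K) (ξ := ξ) (l := l) (γ₀ := γ₀)
  unfold countConst
  positivity

lemma countConst_le_discCount {γ₀ : ℝ} (hK : 2 ≤ K) (hγ₀ : 0 < γ₀) (hγ : γ₀ ≤ γ) (hγ1 : γ ≤ 1)
    (hξ : 0 < ξ)
    (hD : IsDUCB T ξ γ A r) (hR : IsIncentivizedRun T γ f x A g r) (hf : IsDrift T l f)
    (hx : ∀ t, t < T → ∀ i, x (t + 1) i ∈ Set.Icc (0 : ℝ) 1) (hKt : K ≤ t) (htT : t ≤ T)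
    (i : Fin K) : countConst K ξ l γ₀ ≤ discCount γ A t i := by
  have hM := one_le_feedbackConst (K := K) (ξ := ξ) (l := l) (γ₀ := γ₀)
  have := (isControlled hK hγ₀ hγ hξ hD hR hf hx).one_le_discCount_mul hγ₀ hγ hγ1 hM
    (Y := 5 * feedbackConst K ξ l γ₀ / (γ₀ ^ (K + 3)) ^ 4)
    (by rw [mul_div_cancel₀]; positivity) hD.init t hKt htT i
  rw [countConst, div_le_iff₀ (by positivity)]
  exact this

/-- Bound for a single compensation, in units of `√(log T)`. -/
def compensationConst (K : ℕ) (ξ : ℝ) (l : ℝ≥0) (κ : ℝ) : ℝ :=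
  (1 + (l : ℝ)) ^ K / √(Real.log 2) + 2 * √ξ / √κ

lemma compensation_le_const {κ : ℝ} (hγ : 0 ≤ γ) (hγ1 : γ ≤ 1) (hξ : 0 ≤ ξ) (hκ : 0 < κ)
    (hD : IsDUCB T ξ γ A r) (hR : IsIncentivizedRun T γ f x A g r) (hf : IsDrift T l f)
    (hx : ∀ t, t < T → ∀ i, x (t + 1) i ∈ Set.Icc (0 : ℝ) 1)
    (hN : ∀ t, K ≤ t → t ≤ T → ∀ i, κ ≤ discCount γ A t i) (hT : 2 ≤ T) (ht : t < T) :
    compensation γ A g r t ≤ compensationConst K ξ l κ * √(Real.log T) := by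
  have hl : (0 : ℝ) ≤ l := l.2
  have hlog2 : 0 < Real.log 2 := Real.log_pos (by norm_num)
  have hlogT : Real.log 2 ≤ Real.log T := Real.log_le_log (by norm_num) (by exact_mod_cast hT)
  rw [compensationConst, add_mul]
  by_cases hKt : K ≤ t
  · calc compensation γ A g r t ≤ radiusScale ξ γ A t / √(discCount γ A t (A (t + 1))) :=
          hD.compensation_le hγ ht hKt
      _ ≤ (2 * √ξ * √(Real.log T)) / √κ := by
          gcongr
          · exact radiusScale_le hγ hγ1 hξ ht.le
          · exact hN t hKt ht.le _
      _ = 2 * √ξ / √κ * √(Real.log T) := by ring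
      _ ≤ _ := le_add_of_nonneg_left (by positivity)
  · calc compensation γ A g r t ≤ (1 + (l : ℝ)) ^ t := hR.compensation_le_pow hf hx hγ ht
      _ ≤ (1 + (l : ℝ)) ^ K := pow_le_pow_right₀ (by linarith) (by omega)
      _ ≤ (1 + (l : ℝ)) ^ K * √(Real.log T) / √(Real.log 2) := by
          rw [le_div_iff₀ (by positivity)]
          gcongr
      _ = (1 + (l : ℝ)) ^ K / √(Real.log 2) * √(Real.log T) := by ring
      _ ≤ _ := le_add_of_nonneg_right (by positivity)

/-- Discrete form of `d√N = dN / (2√N)`: it lets drifts of size `1 / √N` telescope into `√N`. The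
bound `N ≥ κ` gives `γ * N + 1 ≤ (1 + 1 / κ) * N`. -/
lemma inv_sqrt_le_sqrt_sub {κ N : ℝ} (hγ : 0 ≤ γ) (hγ1 : γ ≤ 1) (hκ : 0 < κ) (hN : κ ≤ N) :
    1 / √N ≤ 2 * √(1 + 1 / κ) * (√(γ * N + 1) - √(γ * N)) := by
  have hN0 : 0 < N := hκ.trans_le hN
  have hγN : γ * N ≤ N := mul_le_of_le_one_left hN0.le hγ1
  have h1 : (√(γ * N + 1) - √(γ * N)) * (√(γ * N + 1) + √(γ * N)) = 1 := by
    have h2 := Real.sq_sqrt (show 0 ≤ γ * N + 1 by positivity)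
    have h3 := Real.sq_sqrt (show 0 ≤ γ * N by positivity)
    linear_combination h2 - h3
  have h2 : √(γ * N + 1) + √(γ * N) ≤ 2 * √(1 + 1 / κ) * √N := by
    have h3 : √(γ * N + 1) ≤ √(1 + 1 / κ) * √N := by
      rw [← Real.sqrt_mul (by positivity)]
      apply Real.sqrt_le_sqrt
      have : 1 ≤ 1 / κ * N := by rw [div_mul_eq_mul_div, one_mul, le_div_iff₀ hκ]; linarith
      linarith
    have h4 : √(γ * N) ≤ √(γ * N + 1) := Real.sqrt_le_sqrt (by linarith)
    linarith
  have h3 : 0 ≤ √(γ * N + 1) - √(γ * N) := sub_nonneg.2 (Real.sqrt_le_sqrt (by linarith))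
  rw [div_le_iff₀ (by positivity)]
  calc 1 = (√(γ * N + 1) - √(γ * N)) * (√(γ * N + 1) + √(γ * N)) := h1.symm
    _ ≤ (√(γ * N + 1) - √(γ * N)) * (2 * √(1 + 1 / κ) * √N) := by gcongr
    _ = _ := by ring

lemma discSum_feedback (hR : IsIncentivizedRun T γ f x A g r) (hf : IsDrift T l f) (ht : t ≤ T)
    (i : Fin K) : discSum γ A r t i = discSum γ A (fun s => x s i) t i +
      discSum γ A (fun s => f s (compensation γ A g r (s - 1))) t i := by
  unfold discSum
  rw [← Finset.sum_add_distrib]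
  refine Finset.sum_congr rfl fun s hs => ?_
  rw [Finset.mem_Icc] at hs
  obtain ⟨s, rfl⟩ : ∃ s', s = s' + 1 := ⟨s - 1, by omega⟩
  split_ifs with hA
  · rw [hR.feedback_eq hf (by omega), hA]
    simp only [Nat.add_sub_cancel]
    ring
  · simp

lemma discSum_drift_nonneg (hγ : 0 ≤ γ) (hR : IsIncentivizedRun T γ f x A g r)
    (hf : IsDrift T l f) (ht : t ≤ T) (i : Fin K) :
    0 ≤ discSum γ A (fun s => f s (compensation γ A g r (s - 1))) t i := by
  refine discSum_nonneg hγ fun s h1 h2 => ?_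
  obtain ⟨s, rfl⟩ : ∃ s', s = s' + 1 := ⟨s - 1, by omega⟩
  exact hR.drift_nonneg hf (by omega)

lemma discCount_le (hγ : 0 ≤ γ) (hγ1 : γ ≤ 1) (i : Fin K) : discCount γ A t i ≤ t := by
  unfold discCount
  calc _ ≤ ∑ s ∈ Finset.Icc 1 t, (1 : ℝ) := by
        refine Finset.sum_le_sum fun s _ => ?_
        split_ifs
        · exact pow_le_one₀ hγ hγ1
        · exact zero_le_one
    _ = t := by simp

/-- The accumulated discounted drift of an arm is of the order of `√N`. -/
lemma discSum_drift_le {κ : ℝ} (hγ : 0 ≤ γ) (hγ1 : γ ≤ 1) (hξ : 0 ≤ ξ) (hκ : 0 < κ)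
    (hD : IsDUCB T ξ γ A r) (hR : IsIncentivizedRun T γ f x A g r) (hf : IsDrift T l f)
    (hx : ∀ t, t < T → ∀ i, x (t + 1) i ∈ Set.Icc (0 : ℝ) 1)
    (hN : ∀ t, K ≤ t → t ≤ T → ∀ i, κ ≤ discCount γ A t i) (hKt : K ≤ t) (htT : t ≤ T)
    (i : Fin K) :
    discSum γ A (fun s => f s (compensation γ A g r (s - 1))) t i ≤ l * (1 + (l : ℝ)) ^ K * K +
      4 * l * √ξ * √(1 + 1 / κ) * √(Real.log T) * √(discCount γ A t i) := by
  have hl : (0 : ℝ) ≤ l := l.2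
  induction t, hKt using Nat.le_induction with
  | base =>
    calc _ ≤ l * (1 + (l : ℝ)) ^ K * discCount γ A K i := by
          refine discSum_le hγ fun s h1 h2 _ => ?_
          obtain ⟨s, rfl⟩ : ∃ s', s = s' + 1 := ⟨s - 1, by omega⟩
          rw [Nat.add_sub_cancel]
          refine (hR.drift_le hf (by omega)).trans ?_
          gcongr
          exact (hR.compensation_le_pow hf hx hγ (by omega)).trans
            (pow_le_pow_right₀ (by linarith) (by omega))
      _ ≤ l * (1 + (l : ℝ)) ^ K * K := by gcongr; exact discCount_le hγ hγ1 i
      _ ≤ _ := le_add_of_nonneg_right (by positivity)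
  | succ t hKt ih =>
    have ih := ih (by omega)
    have hNt := hN t hKt (by omega) i
    have hN0 : 0 < discCount γ A t i := hκ.trans_le hNt
    rw [discSum_succ, discCount_succ]
    set N := discCount γ A t i
    set C := l * (1 + (l : ℝ)) ^ K * K
    have hC : 0 ≤ C := by positivity
    set B := 4 * l * √ξ * √(1 + 1 / κ) * √(Real.log T) with hB
    have hB0 : 0 ≤ B := by positivity
    have h1 : γ * discSum γ A (fun s => f s (compensation γ A g r (s - 1))) t i ≤
        C + B * √(γ * N) := by
      -- Discounting shrinks the drift by `γ` but the comparison function only by `√γ`, so rounds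
      -- without a pull preserve the bound.
      have h2 : γ * √N ≤ √(γ * N) := by
        rw [Real.sqrt_mul hγ]
        gcongr
        exact Real.le_sqrt_of_sq_le (pow_le_of_le_one hγ hγ1 two_ne_zero)
      calc _ ≤ γ * (C + B * √N) := by gcongr
        _ = γ * C + B * (γ * √N) := by ring
        _ ≤ C + B * √(γ * N) := by
          gcongr
          exact mul_le_of_le_one_left hC hγ1
    split_ifs with hA
    · have h2 : f (t + 1) (compensation γ A g r t) ≤ B * (√(γ * N + 1) - √(γ * N)) := by
        calc f (t + 1) (compensation γ A g r t) ≤ l * compensation γ A g r t :=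
              hR.drift_le hf (by omega)
          _ ≤ l * ((2 * √ξ * √(Real.log T)) / √N) := by
              gcongr
              refine (hD.compensation_le hγ (by omega) hKt).trans ?_
              rw [hA]
              gcongr
              exact radiusScale_le hγ hγ1 hξ (by omega)
          _ = l * (2 * √ξ * √(Real.log T)) * (1 / √N) := by ring
          _ ≤ l * (2 * √ξ * √(Real.log T)) *
              (2 * √(1 + 1 / κ) * (√(γ * N + 1) - √(γ * N))) := by
              gcongr
              exact inv_sqrt_le_sqrt_sub hγ hγ1 hκ hNt
          _ = _ := by rw [hB]; ring
      rw [Nat.add_sub_cancel]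
      linarith
    · simpa using h1

/-- The number of pulls of an arm at times where its discounted count is below `m`. -/
lemma card_pulls_le {m : ℝ} (hγ : 0 ≤ γ) (hγ1 : γ ≤ 1) (hm : 0 ≤ m) (a : Fin K) (T : ℕ) :
    (((Finset.range T).filter fun t => A (t + 1) = a ∧ discCount γ A t a < m).card : ℝ) ≤
      (m + 1) * (1 + (1 - γ) * T) := by
  classical
  set p : ℕ → ℝ := fun s => if discCount γ A (s - 1) a < m then 1 else 0 with hp
  have hp0 : ∀ s, 0 ≤ p s := fun s => by simp only [hp]; split_ifs <;> norm_num
  set W := fun t => discSum γ A p t a with hW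
  have hW0 : ∀ t, 0 ≤ W t := fun t => discSum_nonneg hγ fun s _ _ => hp0 s
  have hWN : ∀ t, W t ≤ discCount γ A t a := fun t => by
    have := discSum_le (w := p) (A := A) (i := a) (t := t) (B := 1) hγ
      fun s _ _ _ => by simp only [hp]; split_ifs <;> norm_num
    simpa using this
  -- `W` increases only when the count, which dominates `W`, is below `m`, and then by at most `1`.
  have hWm : ∀ t, W t ≤ m + 1 := by
    intro t
    induction t with
    | zero => simp [hW, discSum_zero]; positivity
    | succ t ih =>
      simp only [hW, discSum_succ]
      change γ * W t + _ ≤ _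
      have h1 : γ * W t ≤ W t := mul_le_of_le_one_left (hW0 t) hγ1
      by_cases h : discCount γ A t a < m
      · have h2 : (if A (t + 1) = a then p (t + 1) else 0) ≤ 1 := by
          simp only [hp]; split_ifs <;> norm_num
        linarith [hWN t]
      · have h2 : (if A (t + 1) = a then p (t + 1) else 0) = 0 := by
          simp [hp, h]
        linarith
  -- Each counted pull contributes `1 = W (t + 1) - γ * W t`. Summation leaves the final `W` and `1
  -- - γ` times the sum of all earlier ones.
  have hcard : ∀ T, (((Finset.range T).filter fun t =>
      A (t + 1) = a ∧ discCount γ A t a < m).card : ℝ) ≤ W T + (m + 1) * ((1 - γ) * T) := by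
    intro T
    induction T with
    | zero => simp [hW, discSum_zero]
    | succ T ih =>
      have hWs : W (T + 1) = γ * W T + if A (T + 1) = a then p (T + 1) else 0 := discSum_succ
      have h1 : (1 - γ) * W T ≤ (1 - γ) * (m + 1) := by
        exact mul_le_mul_of_nonneg_left (hWm T) (by linarith)
      rw [Finset.range_add_one, Finset.filter_insert]
      push_cast
      split_ifs with h
      · rw [Finset.card_insert_of_notMem (by simp)]
        have h2 : (if A (T + 1) = a then p (T + 1) else 0) = 1 := by simp [hp, h.1, h.2]
        push_cast
        rw [hWs, h2]
        linarith
      · have h2 : 0 ≤ if A (T + 1) = a then p (T + 1) else 0 := by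
          split_ifs
          · exact hp0 _
          · exact le_rfl
        rw [hWs]
        linarith
  have := hcard T
  have := hWm T
  linarith

end Trajectory

/-! ### Vanishing compensation when the rewards are concentrated. -/

section GoodEvent

/-- With `v = √(L / N)` this optimizes the normalized deviation `2 ^ j * L / N + 1 / (8 * 2 ^ j)`
over the scale. A dyadic scale with `1 / 2 < v * 2 ^ j ≤ 1` gives `5 / 4 * v`. If `v` is too small
for the grid, the finest scale leaves the additive error, which is later absorbed in the gap; so a
fixed number of scales suffices. -/
lemma exists_dyadic_tradeoff {v : ℝ} (hv0 : 0 ≤ v) (hv1 : v ≤ 1) (J : ℕ) :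
    ∃ j ≤ J, v ^ 2 * 2 ^ j + 1 / (8 * 2 ^ j) ≤ 5 / 4 * v + 1 / (8 * 2 ^ J) := by
  suffices h : (∃ j ≤ J, v ^ 2 * 2 ^ j + 1 / (8 * 2 ^ j) ≤ 5 / 4 * v) ∨ v * 2 ^ J ≤ 1 by
    rcases h with ⟨j, hj, h⟩ | h
    · exact ⟨j, hj, h.trans (le_add_of_nonneg_right (by positivity))⟩
    · refine ⟨J, le_rfl, ?_⟩
      have : v ^ 2 * 2 ^ J ≤ v * 1 := by
        calc v ^ 2 * 2 ^ J = v * (v * 2 ^ J) := by ring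
          _ ≤ v * 1 := by gcongr
      linarith
  induction J with
  | zero => right; simpa using hv1
  | succ J ih =>
    rcases ih with ⟨j, hj, h⟩ | h
    · exact Or.inl ⟨j, by omega, h⟩
    · by_cases h2 : v * 2 ^ (J + 1) ≤ 1
      · exact Or.inr h2
      · left
        refine ⟨J, by omega, ?_⟩
        push Not at h2
        have h3 : v ^ 2 * 2 ^ J ≤ v * 1 := by
          calc v ^ 2 * 2 ^ J = v * (v * 2 ^ J) := by ring
            _ ≤ v * 1 := by gcongr
        have h4 : 1 / (8 * 2 ^ J) ≤ 1 / 4 * v := by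
          rw [div_le_iff₀ (by positivity)]
          rw [pow_succ] at h2
          linarith
        linarith

variable {K T : ℕ} {ξ γ : ℝ} {l : ℝ≥0} {f : ℕ → ℝ → ℝ} {x : ℕ → Fin K → ℝ} {A g : ℕ → Fin K}
  {r : ℕ → ℝ} {t : ℕ}

/-- Constant in the bound for the discounted drift that multiplies `√(log T) √N`. -/
def driftConst (ξ : ℝ) (l : ℝ≥0) (κ : ℝ) : ℝ := 4 * l * √ξ * √(1 + 1 / κ)

/-- A count threshold `m = M log T` is sufficient for the gap `Δ` if the statistical error, the
drift, and the confidence radius of an arm with discounted count `m` are small compared to `Δ`. -/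
structure IsSufficient (K : ℕ) (ξ : ℝ) (l : ℝ≥0) (κ Δ : ℝ) (J : ℕ) (M : ℝ) : Prop where
  pos : 0 < M
  gap : 1 ≤ Δ * 2 ^ J / 2
  dyadic : 2 ^ J ≤ Δ / 16 * M
  init : l * (1 + (l : ℝ)) ^ K * K ≤ Δ / 32 * (M * Real.log 2)
  drift : driftConst ξ l κ ≤ Δ / 32 * √M
  radius : 2 * √ξ ≤ Δ / 16 * √M

lemma exists_isSufficient (K : ℕ) (ξ : ℝ) (l : ℝ≥0) (κ : ℝ) {Δ : ℝ} (hΔ : 0 < Δ) :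
    ∃ J M, IsSufficient K ξ l κ Δ J M := by
  obtain ⟨J, hJ⟩ := pow_unbounded_of_one_lt (2 / Δ) (one_lt_two (α := ℝ))
  have hlog : 0 < Real.log 2 := Real.log_pos (by norm_num)
  have h1 : ∀ᶠ M : ℝ in Filter.atTop, 0 < M := Filter.eventually_gt_atTop 0
  have h2 : ∀ᶠ M : ℝ in Filter.atTop, 2 ^ J ≤ Δ / 16 * M :=
    (Filter.tendsto_id.const_mul_atTop (by positivity)).eventually_ge_atTop _
  have h3 : ∀ᶠ M : ℝ in Filter.atTop, l * (1 + (l : ℝ)) ^ K * K ≤ Δ / 32 * (M * Real.log 2) :=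
    ((Filter.tendsto_id.atTop_mul_const hlog).const_mul_atTop
      (by positivity)).eventually_ge_atTop _
  have hs : Filter.Tendsto Real.sqrt Filter.atTop Filter.atTop := Real.tendsto_sqrt_atTop
  have h4 : ∀ᶠ M : ℝ in Filter.atTop, driftConst ξ l κ ≤ Δ / 32 * √M :=
    (hs.const_mul_atTop (by positivity)).eventually_ge_atTop _
  have h5 : ∀ᶠ M : ℝ in Filter.atTop, 2 * √ξ ≤ Δ / 16 * √M :=
    (hs.const_mul_atTop (by positivity)).eventually_ge_atTop _
  obtain ⟨M, h1, h2, h3, h4, h5⟩ := (h1.and (h2.and (h3.and (h4.and h5)))).exists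
  refine ⟨J, M, h1, ?_, h2, h3, h4, h5⟩
  rw [div_lt_iff₀ hΔ] at hJ
  linarith

/-- The discounted sums of the rewards are close to their means, on all dyadic scales. -/
def IsConcentrated (γ b₀ : ℝ) (J : ℕ) (A : ℕ → Fin K) (x : ℕ → Fin K → ℝ) (t : ℕ)
    (μ : Fin K → ℝ) : Prop :=
  ∀ i, ∀ j ≤ J, |discSum γ A (fun s => x s i) t i - μ i * discCount γ A t i| ≤
    b₀ + (2 ^ j * Real.log (discTotal γ A t) + discCount γ A t i / (8 * 2 ^ j))

section Consequences

variable {κ Δ b₀ M : ℝ} {J : ℕ} {μ : Fin K → ℝ} (hγ : 0 ≤ γ) (hγ1 : γ ≤ 1) (hκ : 0 < κ)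
  (hs : IsSufficient K ξ l κ Δ J M) (hΔ : 0 < Δ) (hb₀ : b₀ ≤ Δ / 16 * κ)
  (hD : IsDUCB T ξ γ A r) (hR : IsIncentivizedRun T γ f x A g r) (hf : IsDrift T l f)
  (hx : ∀ t, t < T → ∀ i, x (t + 1) i ∈ Set.Icc (0 : ℝ) 1)
  (hN : ∀ t, K ≤ t → t ≤ T → ∀ i, κ ≤ discCount γ A t i) (hT : 2 ≤ T) (htT : t < T)
  (hKt : K ≤ t) (hc : IsConcentrated γ b₀ J A x t μ)

include hs in
lemma IsSufficient.one_div_le : 1 / (8 * 2 ^ J) ≤ Δ / 16 := by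
  rw [div_le_div_iff₀ (by positivity) (by norm_num)]
  linarith [hs.gap]

include hγ hγ1 hκ hs hΔ hb₀ hN htT hKt hc hT in
lemma abs_rewardMean_sub_le (i : Fin K) (hm : M * Real.log T ≤ discCount γ A t i) :
    |discSum γ A (fun s => x s i) t i - μ i * discCount γ A t i| ≤
      3 * Δ / 16 * discCount γ A t i := by
  have hNi := hN t hKt htT.le i
  have hlog : 0 < Real.log T := Real.log_pos (by exact_mod_cast (by omega : 1 < T))
  have hL : Real.log (discTotal γ A t) ≤ Real.log T := log_discTotal_le hγ hγ1 htT.le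
  refine (hc i J le_rfl).trans ?_
  set N := discCount γ A t i
  have h1 : b₀ ≤ Δ / 16 * N := hb₀.trans (by gcongr)
  have h2 : 2 ^ J * Real.log (discTotal γ A t) ≤ Δ / 16 * N := by
    calc 2 ^ J * Real.log (discTotal γ A t) ≤ Δ / 16 * M * Real.log T := by
          exact mul_le_mul hs.dyadic hL (log_discTotal_nonneg hγ t)
            ((pow_nonneg zero_le_two J).trans hs.dyadic)
      _ = Δ / 16 * (M * Real.log T) := by ring
      _ ≤ _ := by gcongr
  have h3 : N / (8 * 2 ^ J) ≤ Δ / 16 * N := by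
    rw [div_eq_mul_one_div, mul_comm]
    exact mul_le_mul_of_nonneg_right (hs.one_div_le) (hκ.le.trans hNi)
  linarith

include hγ hγ1 hκ hs hΔ hD hR hf hx hN htT hKt hT in
lemma discSum_drift_le_gap (hξ : 0 ≤ ξ) (i : Fin K) (hm : M * Real.log T ≤ discCount γ A t i) :
    discSum γ A (fun s => f s (compensation γ A g r (s - 1))) t i ≤
      Δ / 16 * discCount γ A t i := by
  have hNi := hN t hKt htT.le i
  have hlogT : Real.log 2 ≤ Real.log T := Real.log_le_log (by norm_num) (by exact_mod_cast hT)
  have hM := hs.pos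
  refine (discSum_drift_le hγ hγ1 hξ hκ hD hR hf hx hN hKt htT.le i).trans ?_
  set N := discCount γ A t i
  have hN0 : 0 < N := hκ.trans_le hNi
  have h1 : l * (1 + (l : ℝ)) ^ K * K ≤ Δ / 32 * N := by
    calc _ ≤ Δ / 32 * (M * Real.log 2) := hs.init
      _ ≤ Δ / 32 * (M * Real.log T) := by gcongr
      _ ≤ _ := by gcongr
  have h2 : driftConst ξ l κ * √(Real.log T) * √N ≤ Δ / 32 * N := by
    calc driftConst ξ l κ * √(Real.log T) * √N ≤ Δ / 32 * √M * √(Real.log T) * √N := by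
          gcongr
          exact hs.drift
      _ = Δ / 32 * √(M * Real.log T) * √N := by
          rw [Real.sqrt_mul hM.le]; ring
      _ ≤ Δ / 32 * √N * √N := by gcongr
      _ = _ := by rw [mul_assoc, Real.mul_self_sqrt hN0.le]
  unfold driftConst at h2
  linarith

include hγ hγ1 hs hΔ htT hT in
lemma discRadius_le_gap (hξ : 0 ≤ ξ) (i : Fin K) (hm : M * Real.log T ≤ discCount γ A t i) :
    discRadius ξ γ A t i ≤ Δ / 16 := by
  have hM := hs.pos
  have hlog : 0 < Real.log T := Real.log_pos (by exact_mod_cast (by omega : 1 < T))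
  have hN0 : 0 < discCount γ A t i := lt_of_lt_of_le (by positivity) hm
  rw [discRadius_eq hγ, div_le_iff₀ (by positivity)]
  calc radiusScale ξ γ A t ≤ 2 * √ξ * √(Real.log T) := radiusScale_le hγ hγ1 hξ htT.le
    _ ≤ Δ / 16 * √M * √(Real.log T) :=
        mul_le_mul_of_nonneg_right hs.radius (Real.sqrt_nonneg _)
    _ = Δ / 16 * √(M * Real.log T) := by rw [Real.sqrt_mul hM.le]; ring
    _ ≤ _ := by gcongr

include hγ hγ1 hκ hs hΔ hb₀ hD hR hf hx hN hT htT hKt hc in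
lemma discMean_le_add_gap (hξ : 0 ≤ ξ) (i : Fin K) (hm : M * Real.log T ≤ discCount γ A t i) :
    discMean γ A r t i ≤ μ i + Δ / 4 := by
  have hN0 : 0 < discCount γ A t i := hκ.trans_le (hN t hKt htT.le i)
  have h1 := (abs_le.1 (abs_rewardMean_sub_le hγ hγ1 hκ hs hΔ hb₀ hN hT htT hKt hc i hm)).2
  have h2 := discSum_drift_le_gap hγ hγ1 hκ hs hΔ hD hR hf hx hN hT htT hKt hξ i hm
  rw [discMean_eq, div_le_iff₀ hN0, discSum_feedback hR hf htT.le]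
  linarith

include hγ hγ1 hκ hs hΔ hb₀ hR hf hN hT htT hKt hc in
lemma sub_gap_le_discMean (i : Fin K) (hm : M * Real.log T ≤ discCount γ A t i) :
    μ i - Δ / 4 ≤ discMean γ A r t i := by
  have hN0 : 0 < discCount γ A t i := hκ.trans_le (hN t hKt htT.le i)
  have h1 := (abs_le.1 (abs_rewardMean_sub_le hγ hγ1 hκ hs hΔ hb₀ hN hT htT hKt hc i hm)).1
  have h2 := discSum_drift_nonneg hγ hR hf htT.le i
  rw [discMean_eq, le_div_iff₀ hN0, discSum_feedback hR hf htT.le]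
  have : 0 < Δ * discCount γ A t i := by positivity
  linarith

include hγ hκ hs hΔ hb₀ hR hf hx hN htT hKt hc in
/-- The upper confidence bound of an arm essentially dominates its mean. -/
lemma sub_gap_le_discUCB (hξ : 1 / 2 < ξ) (i : Fin K) (hμ : μ i ≤ 1) :
    μ i - Δ / 8 ≤ discUCB ξ γ A r t i := by
  have hNi := hN t hKt htT.le i
  have hN0 : 0 < discCount γ A t i := hκ.trans_le hNi
  have hmean : 0 ≤ discMean γ A r t i :=
    discMean_nonneg hγ fun s h1 h2 => hR.feedback_nonneg hf hx s h1 (by omega)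
  have hL := log_discTotal_nonneg (A := A) hγ t
  have hdrift := discSum_drift_nonneg hγ hR hf htT.le i
  have hsum := discSum_feedback hR hf htT.le i
  unfold discUCB
  -- For a small count the radius alone is at least `1`, which dominates every mean.
  by_cases hcase : discCount γ A t i ≤ 4 * (ξ * Real.log (discTotal γ A t))
  · have : 1 ≤ discRadius ξ γ A t i := by
      unfold discRadius
      have h1 : 1 / 2 ≤ √(ξ * Real.log (discTotal γ A t) / discCount γ A t i) := by
        apply Real.le_sqrt_of_sq_le
        rw [le_div_iff₀ hN0]
        linarith
      linarith
    linarith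
  · push Not at hcase
    set N := discCount γ A t i
    set L := Real.log (discTotal γ A t) with hLdef
    set v := √(L / N) with hv
    have hv0 : 0 ≤ v := Real.sqrt_nonneg _
    have hv2 : v ^ 2 = L / N := Real.sq_sqrt (by positivity)
    have hv1 : v ≤ 1 := by
      rw [hv, Real.sqrt_le_one, div_le_one hN0]
      nlinarith
    obtain ⟨j, hj, h⟩ := exists_dyadic_tradeoff hv0 hv1 J
    have h1 := (abs_le.1 (hc i j hj)).1
    have hrad : 5 / 4 * v ≤ discRadius ξ γ A t i := by
      -- Here `ξ > 1 / 2` is used: `2 * √ξ ≥ 5 / 4` makes the radius cover the dyadic deviation.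
      -- Only the nonnegativity of the drift is needed for this lower bound.
      have h2 : 5 / 8 ≤ √ξ := Real.le_sqrt_of_sq_le (by norm_num; linarith)
      have h3 : discRadius ξ γ A t i = 2 * (√ξ * v) := by
        rw [discRadius, hv, ← Real.sqrt_mul (by linarith), mul_div_assoc]
      rw [h3]
      nlinarith
    have h2 : μ i - Δ / 16 - (v ^ 2 * 2 ^ j + 1 / (8 * 2 ^ j)) ≤ discMean γ A r t i := by
      rw [discMean_eq, le_div_iff₀ hN0, hsum]
      have h3 : v ^ 2 * N = L := by rw [hv2]; field_simp
      have h4 : b₀ ≤ Δ / 16 * N := hb₀.trans (by gcongr)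
      have h5 : 1 / (8 * 2 ^ j) * N = N / (8 * 2 ^ j) := by ring
      calc (μ i - Δ / 16 - (v ^ 2 * 2 ^ j + 1 / (8 * 2 ^ j))) * N =
          μ i * N - Δ / 16 * N - (2 ^ j * (v ^ 2 * N) + 1 / (8 * 2 ^ j) * N) := by ring
        _ ≤ _ := by rw [h3, h5]; linarith
    have h6 := hs.one_div_le
    linarith

include hγ hγ1 hκ hs hΔ hb₀ hD hR hf hx hN hT htT hKt hc in
/-- In a round in which the rewards are concentrated, no compensation is paid for an arm with a
large discounted count. -/
lemma compensation_eq_zero (hξ : 1 / 2 < ξ) (hμ : ∀ i, μ i ≤ 1) (b : Fin K)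
    (hb : ∀ i, i ≠ b → Δ ≤ μ b - μ i) (hm : M * Real.log T ≤ discCount γ A t (A (t + 1))) :
    compensation γ A g r t = 0 := by
  have hξ0 : 0 ≤ ξ := by linarith
  refine le_antisymm ?_ (hR.compensation_nonneg htT)
  by_contra! hpos
  set a := A (t + 1) with ha
  set i := g (t + 1) with hi
  have hia : i ≠ a := by
    intro h
    rw [compensation, ← hi, ← ha, h, sub_self] at hpos
    exact lt_irrefl _ hpos
  have hlt : discRadius ξ γ A t i < discRadius ξ γ A t a := by
    have := hD.compensation_le_sub (g := g) htT hKt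
    rw [← hi, ← ha] at this
    linarith
  -- A positive compensation forces the greedy arm to have the smaller radius, hence at least the
  -- count of the pulled arm; so its mean is accurate too.
  have hNi : discCount γ A t a ≤ discCount γ A t i := by
    by_contra! hcon
    have h0 : 0 < discCount γ A t i := hκ.trans_le (hN t hKt htT.le i)
    have h1 : 0 < discCount γ A t a := hκ.trans_le (hN t hKt htT.le a)
    rw [discRadius_eq hγ, discRadius_eq hγ] at hlt
    refine absurd hlt (not_lt.2 ?_)
    gcongr
    exact radiusScale_nonneg
  have hup : discUCB ξ γ A r t a ≤ μ a + 5 * Δ / 16 := by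
    have h1 := discMean_le_add_gap hγ hγ1 hκ hs hΔ hb₀ hD hR hf hx hN hT htT hKt hc hξ0 a hm
    have h2 := discRadius_le_gap (A := A) hγ hγ1 hs hΔ hT htT hξ0 a hm
    unfold discUCB
    linarith
  -- If the pulled arm is the best one, its empirical mean beats that of the greedy arm. Otherwise
  -- its upper confidence bound lies below that of the best arm, against the UCB rule.
  by_cases hab : a = b
  · have h1 := discMean_le_add_gap hγ hγ1 hκ hs hΔ hb₀ hD hR hf hx hN hT htT hKt hc hξ0 i
      (hm.trans hNi)
    have h2 := sub_gap_le_discMean hγ hγ1 hκ hs hΔ hb₀ hR hf hN hT htT hKt hc a hm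
    have h3 := hb i (hab ▸ hia)
    rw [compensation, ← hi, ← ha] at hpos
    rw [← hab] at h3
    linarith
  · have h1 := hD.argmax t htT hKt b
    have h2 := sub_gap_le_discUCB hγ hκ hs hΔ hb₀ hR hf hx hN htT hKt hc hξ b (hμ b)
    have h3 := hb a hab
    rw [← ha] at h1
    linarith

end Consequences

end GoodEvent

/-! ### Exponential supermartingales and self-normalized deviations. -/

section Concentration

variable {Ω : Type*} {mΩ : MeasurableSpace Ω} {P : Measure Ω} {ℱ : Filtration ℕ mΩ} {K T : ℕ}
  {X : ℕ → Fin K → Ω → ℝ} {A : ℕ → Ω → Fin K}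

lemma measurableSet_pull {m : MeasurableSpace Ω} {Y : Ω → Fin K} (hY : Measurable[m] Y)
    (i : Fin K) : MeasurableSet[m] {ω | Y ω = i} :=
  hY (measurableSet_singleton i)

lemma measurable_discSum {m : MeasurableSpace Ω} {γ : ℝ} {W : ℕ → Ω → ℝ} {t : ℕ} {i : Fin K}
    (hA : ∀ s, 1 ≤ s → s ≤ t → Measurable[m] (A s))
    (hW : ∀ s, 1 ≤ s → s ≤ t → Measurable[m] (W s)) :
    Measurable[m] fun ω => discSum γ (fun s => A s ω) (fun s => W s ω) t i := by
  unfold discSum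
  refine Finset.measurable_fun_sum _ fun s hs => ?_
  rw [Finset.mem_Icc] at hs
  exact Measurable.ite (measurableSet_pull (hA s hs.1 hs.2) i)
    ((hW s hs.1 hs.2).const_mul _) measurable_const

namespace IsRewardProcess

lemma measurable (hX : IsRewardProcess T P ℱ X) {s : ℕ} (h1 : 1 ≤ s) (h2 : s ≤ T) (i : Fin K) :
    Measurable (X s i) :=
  (hX.adapted s (Finset.mem_Icc.2 ⟨h1, h2⟩) i).mono (ℱ.le s) le_rfl

/-- Hoeffding's lemma for a variable with values in an interval of length `1`. -/
lemma lintegral_exp_le [IsProbabilityMeasure P] (hX : IsRewardProcess T P ℱ X) {t : ℕ} (ht : t < T)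
    (i : Fin K) (θ : ℝ) :
    ∫⁻ ω, ENNReal.ofReal
      (Real.exp (θ * (X (t + 1) i ω - ∫ ω', X (t + 1) i ω' ∂P) - θ ^ 2 / 8)) ∂P ≤ 1 := by
  have hm : t + 1 ∈ Finset.Icc 1 T := Finset.mem_Icc.2 ⟨by omega, by omega⟩
  have hsub := hasSubgaussianMGF_of_mem_Icc
    (hX.measurable (by omega) ht i).aemeasurable (hX.mem_Icc _ hm i)
  have hint := hsub.integrable_exp_mul θ
  have hle := hsub.mgf_le θ
  simp_rw [sub_eq_add_neg _ (θ ^ 2 / 8), Real.exp_add]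
  rw [← ofReal_integral_eq_lintegral_ofReal (hint.mul_const _)
    (Filter.Eventually.of_forall fun ω => by positivity), integral_mul_const]
  rw [ENNReal.ofReal_le_one]
  unfold mgf at hle
  calc _ ≤ _ := mul_le_mul_of_nonneg_right hle (Real.exp_pos _).le
    _ = 1 := by
      rw [← Real.exp_add, Real.exp_eq_one_iff]
      push_cast
      rw [sub_zero, norm_one]
      ring

/-- Summand of the exponent of the supermartingale that controls the rewards of arm `i`. -/
def expSummand (P : Measure Ω) (X : ℕ → Fin K → Ω → ℝ) (A : ℕ → Ω → Fin K) (i : Fin K)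
    (θ : ℕ → ℝ) (s : ℕ) (ω : Ω) : ℝ :=
  if A s ω = i then θ s * (X s i ω - ∫ ω', X s i ω' ∂P) - θ s ^ 2 / 8 else 0

/-- The pulled arm is known one round ahead and the next reward vector is independent of the past.
On the event that arm `i` is pulled the new factor splits off with mean at most `1`; elsewhere it
equals `1`. -/
lemma lintegral_exp_sum_le [IsProbabilityMeasure P] (hX : IsRewardProcess T P ℱ X)
    (hA : ∀ t, t < T → Measurable[ℱ t] (A (t + 1))) (i : Fin K) (θ : ℕ → ℝ) {t : ℕ} (ht : t ≤ T) :
    ∫⁻ ω, ENNReal.ofReal (Real.exp (∑ s ∈ Finset.Icc 1 t, expSummand P X A i θ s ω)) ∂P ≤ 1 := by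
  induction t with
  | zero => simp
  | succ t ih =>
    have ih := ih (by omega)
    set Y : Ω → ENNReal :=
      fun ω => ENNReal.ofReal (Real.exp (∑ s ∈ Finset.Icc 1 t, expSummand P X A i θ s ω)) with hY
    have hYm : Measurable[ℱ t] Y := by
      refine ENNReal.measurable_ofReal.comp (Real.measurable_exp.comp
        (Finset.measurable_fun_sum _ fun s hs => ?_))
      rw [Finset.mem_Icc] at hs
      obtain ⟨s, rfl⟩ : ∃ s', s = s' + 1 := ⟨s - 1, by omega⟩
      have h1 : Measurable[ℱ t] (A (s + 1)) :=
        (hA s (by omega)).mono (ℱ.mono (by omega)) le_rfl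
      have h2 : Measurable[ℱ t] (X (s + 1) i) :=
        (hX.adapted (s + 1) (Finset.mem_Icc.2 ⟨by omega, by omega⟩) i).mono
          (ℱ.mono (by omega)) le_rfl
      exact Measurable.ite (measurableSet_pull h1 i)
        (((h2.sub_const _).const_mul _).sub_const _) measurable_const
    set h : Ω → ENNReal := fun ω => ENNReal.ofReal
      (Real.exp (θ (t + 1) * (X (t + 1) i ω - ∫ ω', X (t + 1) i ω' ∂P) - θ (t + 1) ^ 2 / 8)) with hh
    have hhm : Measurable[MeasurableSpace.comap (fun ω i => X (t + 1) i ω) MeasurableSpace.pi] h := by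
      have h1 : Measurable fun y : Fin K → ℝ => ENNReal.ofReal
        (Real.exp (θ (t + 1) * (y i - ∫ ω', X (t + 1) i ω' ∂P) - θ (t + 1) ^ 2 / 8)) := by
        fun_prop
      exact h1.comp (comap_measurable _)
    have hind := hX.indep t (by omega)
    have hle : MeasurableSpace.comap (fun ω i => X (t + 1) i ω) MeasurableSpace.pi ≤ mΩ :=
      (measurable_pi_lambda _ fun i => hX.measurable (by omega) ht i).comap_le
    have hS := measurableSet_pull (hA t (by omega)) i
    set S := {ω | A (t + 1) ω = i} with hSdef
    have hsplit : ∀ ω, ENNReal.ofReal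
        (Real.exp (∑ s ∈ Finset.Icc 1 (t + 1), expSummand P X A i θ s ω)) =
        S.indicator Y ω * h ω + Sᶜ.indicator Y ω := by
      intro ω
      rw [Finset.sum_Icc_succ_top (by omega), Real.exp_add, ENNReal.ofReal_mul (Real.exp_pos _).le]
      by_cases hω : A (t + 1) ω = i
      · have h1 : ω ∈ S := hω
        simp [h1, hh, hY, expSummand, hω]
      · have h1 : ω ∉ S := hω
        simp [h1, hY, expSummand, hω]
    simp_rw [hsplit]
    have hm1 : Measurable[ℱ t] (S.indicator Y) := hYm.indicator hS
    have hm2 : Measurable fun ω => S.indicator Y ω * h ω :=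
      (hm1.mono (ℱ.le t) le_rfl).mul (hhm.mono hle le_rfl)
    rw [lintegral_add_left hm2,
      lintegral_mul_eq_lintegral_mul_lintegral_of_independent_measurableSpace (ℱ.le t) hle
        hind.symm hm1 hhm]
    calc _ ≤ (∫⁻ ω, S.indicator Y ω ∂P) * 1 + ∫⁻ ω, Sᶜ.indicator Y ω ∂P := by
          gcongr
          exact hX.lintegral_exp_le (by omega) i _
      _ = ∫⁻ ω, Y ω ∂P := by
          rw [mul_one, ← lintegral_add_left (hm1.mono (ℱ.le t) le_rfl)]
          simp_rw [Set.indicator_self_add_compl_apply]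
      _ ≤ 1 := ih

/-- One-sided self-normalized deviation bound for the discounted sum of the rewards of an arm. -/
lemma measure_lt_le [IsProbabilityMeasure P] (hX : IsRewardProcess T P ℱ X)
    (hA : ∀ t, t < T → Measurable[ℱ t] (A (t + 1))) {γ : ℝ} (hγ : 0 ≤ γ) (hγ1 : γ ≤ 1) (i : Fin K)
    (θ L : ℝ) {t : ℕ} (ht : t ≤ T) :
    P {ω | L + θ ^ 2 / 8 * discCount γ (fun s => A s ω) t i < θ *
      discSum γ (fun s => A s ω) (fun s => X s i ω - ∫ ω', X s i ω' ∂P) t i} ≤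
      ENNReal.ofReal (Real.exp (-L)) := by
  -- For frozen `t` the discount weights are deterministic. The quadratic term carries `γ ^ (2 * (t
  -- - s)) ≤ γ ^ (t - s)`, so it is controlled by `N_t(γ, i)` itself.
  have hle := hX.lintegral_exp_sum_le hA i (fun s => θ * γ ^ (t - s)) ht
  have hmeas : Measurable fun ω => ENNReal.ofReal (Real.exp (∑ s ∈ Finset.Icc 1 t,
      expSummand P X A i (fun s => θ * γ ^ (t - s)) s ω)) := by
    refine ENNReal.measurable_ofReal.comp (Real.measurable_exp.comp
        (Finset.measurable_fun_sum _ fun s hs => ?_))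
    rw [Finset.mem_Icc] at hs
    obtain ⟨s, rfl⟩ : ∃ s', s = s' + 1 := ⟨s - 1, by omega⟩
    exact Measurable.ite
      (measurableSet_pull ((hA s (by omega)).mono (ℱ.le s) le_rfl) i)
      ((((hX.measurable (by omega) (by omega) i).sub_const _).const_mul _).sub_const _)
      measurable_const
  have hmarkov := (mul_meas_ge_le_lintegral hmeas (ENNReal.ofReal (Real.exp L))).trans hle
  have hsub : {ω | L + θ ^ 2 / 8 * discCount γ (fun s => A s ω) t i < θ *
      discSum γ (fun s => A s ω) (fun s => X s i ω - ∫ ω', X s i ω' ∂P) t i} ⊆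
      {ω | ENNReal.ofReal (Real.exp L) ≤ ENNReal.ofReal (Real.exp (∑ s ∈ Finset.Icc 1 t,
      expSummand P X A i (fun s => θ * γ ^ (t - s)) s ω))} := by
    intro ω hω
    rw [Set.mem_ofPred_eq] at hω ⊢
    apply ENNReal.ofReal_le_ofReal
    apply Real.exp_le_exp.2
    have h1 : θ * discSum γ (fun s => A s ω) (fun s => X s i ω - ∫ ω', X s i ω' ∂P) t i -
        θ ^ 2 / 8 * discCount γ (fun s => A s ω) t i ≤ ∑ s ∈ Finset.Icc 1 t,
        expSummand P X A i (fun s => θ * γ ^ (t - s)) s ω := by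
      unfold discSum discCount
      rw [Finset.mul_sum, Finset.mul_sum, ← Finset.sum_sub_distrib]
      refine Finset.sum_le_sum fun s _ => ?_
      unfold expSummand
      split_ifs
      · have h2 : (γ ^ (t - s)) ^ 2 ≤ γ ^ (t - s) :=
          pow_le_of_le_one (pow_nonneg hγ _) (pow_le_one₀ hγ hγ1) two_ne_zero
        have h3 : θ ^ 2 / 8 * (γ ^ (t - s)) ^ 2 ≤ θ ^ 2 / 8 * γ ^ (t - s) := by gcongr
        linarith
      · simp
    linarith
  calc _ ≤ _ := measure_mono hsub
    _ ≤ (ENNReal.ofReal (Real.exp L))⁻¹ := by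
        rw [ENNReal.le_inv_iff_mul_le, mul_comm]
        exact hmarkov
    _ = _ := by rw [← ENNReal.ofReal_inv_of_pos (Real.exp_pos _), Real.exp_neg]

end IsRewardProcess

/-- The event that the discounted rewards of some arm deviate from their means. -/
def deviationEvent (P : Measure Ω) (X : ℕ → Fin K → Ω → ℝ) (A : ℕ → Ω → Fin K) (γ L : ℝ)
    (J t : ℕ) : Set Ω :=
  ⋃ i : Fin K, ⋃ j ∈ Finset.range (J + 1),
    {ω | 2 ^ j * L + discCount γ (fun s => A s ω) t i / (8 * 2 ^ j) <
      |discSum γ (fun s => A s ω) (fun s => X s i ω - ∫ ω', X s i ω' ∂P) t i|}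

lemma IsRewardProcess.measurableSet_deviationEvent (hX : IsRewardProcess T P ℱ X)
    (hA : ∀ t, t < T → Measurable[ℱ t] (A (t + 1))) (γ L : ℝ) (J : ℕ) {t : ℕ} (ht : t ≤ T) :
    MeasurableSet (deviationEvent P X A γ L J t) := by
  have hA' : ∀ s, 1 ≤ s → s ≤ t → Measurable (A s) := by
    intro s h1 h2
    obtain ⟨s, rfl⟩ : ∃ s', s = s' + 1 := ⟨s - 1, by omega⟩
    exact (hA s (by omega)).mono (ℱ.le s) le_rfl
  refine MeasurableSet.iUnion fun i => Finset.measurableSet_biUnion _ fun j _ =>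
    measurableSet_lt ?_ ?_
  · simp_rw [discCount_eq_discSum]
    exact ((measurable_discSum hA' fun _ _ _ => measurable_const).div_const _).const_add _
  · exact (measurable_discSum hA' fun s h1 h2 =>
      (hX.measurable h1 (by omega) i).sub_const _).abs

lemma IsRewardProcess.measure_deviationEvent_le [IsProbabilityMeasure P]
    (hX : IsRewardProcess T P ℱ X)
    (hA : ∀ t, t < T → Measurable[ℱ t] (A (t + 1))) {γ : ℝ} (hγ : 0 ≤ γ) (hγ1 : γ ≤ 1)
    (L : ℝ) (J : ℕ) {t : ℕ} (ht : t ≤ T) :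
    P (deviationEvent P X A γ L J t) ≤ ENNReal.ofReal (2 * K * (J + 1) * Real.exp (-L)) := by
  have hone : ∀ i : Fin K, ∀ j : ℕ, P {ω | 2 ^ j * L + discCount γ (fun s => A s ω) t i / (8 * 2 ^ j) <
      |discSum γ (fun s => A s ω) (fun s => X s i ω - ∫ ω', X s i ω' ∂P) t i|} ≤
      ENNReal.ofReal (2 * Real.exp (-L)) := by
    intro i j
    have h2 : (0 : ℝ) < 2 ^ j := by positivity
    set p : ℝ := 2 ^ j
    -- The choice `θ = ± 2 ^ (-j)` turns the threshold `(L + θ ^ 2 * N / 8) / |θ|` into `2 ^ j * L +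
    -- N / (8 * 2 ^ j)`.
    have h1 := hX.measure_lt_le hA hγ hγ1 i (1 / p) L ht
    have h3 := hX.measure_lt_le hA hγ hγ1 i (-(1 / p)) L ht
    rw [two_mul, ENNReal.ofReal_add (Real.exp_pos _).le (Real.exp_pos _).le]
    refine le_trans (le_trans (measure_mono ?_) (measure_union_le _ _)) (add_le_add h1 h3)
    intro ω hω
    rw [Set.mem_ofPred_eq] at hω
    set D := discSum γ (fun s => A s ω) (fun s => X s i ω - ∫ ω', X s i ω' ∂P) t i with hD
    set N := discCount γ (fun s => A s ω) t i with hN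
    have hscale : L + (1 / p) ^ 2 / 8 * N = 1 / p * (p * L + N / (8 * p)) := by
      field_simp
    rcases lt_abs.1 hω with h | h
    · left
      rw [Set.mem_ofPred_eq, ← hD, ← hN, hscale]
      gcongr
    · right
      rw [Set.mem_ofPred_eq, ← hD, ← hN, neg_sq, hscale, neg_mul_comm]
      gcongr
  calc P (deviationEvent P X A γ L J t) ≤ ∑ i : Fin K, P (⋃ j ∈ Finset.range (J + 1),
        {ω | 2 ^ j * L + discCount γ (fun s => A s ω) t i / (8 * 2 ^ j) <
        |discSum γ (fun s => A s ω) (fun s => X s i ω - ∫ ω', X s i ω' ∂P) t i|}) :=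
        measure_iUnion_fintype_le _ _
    _ ≤ ∑ i : Fin K, ∑ j ∈ Finset.range (J + 1), ENNReal.ofReal (2 * Real.exp (-L)) := by
        refine Finset.sum_le_sum fun i _ => (measure_biUnion_finset_le _ _).trans ?_
        exact Finset.sum_le_sum fun j _ => hone i j
    _ = _ := by
        simp only [Finset.sum_const, Finset.card_range, Finset.card_univ, Fintype.card_fin,
          nsmul_eq_mul]
        rw [← ENNReal.ofReal_natCast, ← ENNReal.ofReal_natCast, ← ENNReal.ofReal_mul (by positivity),
          ← ENNReal.ofReal_mul (by positivity)]
        congr 1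
        push_cast
        ring

end Concentration

/-! ### The bias caused by rewards from before a breakpoint. -/

section Bias

variable {K : ℕ} {γ : ℝ} {A : ℕ → Fin K} {w : ℕ → ℝ} {i : Fin K}

lemma discSum_eq_of_eq_zero {u v : ℕ} (huv : u ≤ v) (h : ∀ s, u < s → s ≤ v → w s = 0) :
    discSum γ A w v i = γ ^ (v - u) * discSum γ A w u i := by
  induction v, huv using Nat.le_induction with
  | base => simp
  | succ v huv ih =>
    rw [discSum_succ, h _ (by omega) le_rfl, ite_self,
      ih fun s h1 h2 => h s h1 (by omega), show v + 1 - u = (v - u) + 1 by omega]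
    ring

lemma discCount_le_inv (hγ : 0 ≤ γ) (hγ1 : γ < 1) (t : ℕ) : discCount γ A t i ≤ 1 / (1 - γ) := by
  have h1 : discCount γ A t i ≤ discTotal γ A t :=
    Finset.single_le_sum (f := fun i => discCount γ A t i)
      (fun j _ => discCount_nonneg hγ) (Finset.mem_univ i)
  refine h1.trans ?_
  rw [le_div_iff₀ (by linarith), mul_comm, one_sub_mul_discTotal]
  linarith [pow_nonneg hγ t]

/-- Only entries of age at least `D` contribute, and their total discounted weight is at most `γ ^ D
/ (1 - γ)`. -/
lemma abs_discSum_le_of_recent_eq_zero (hγ : 0 ≤ γ) (hγ1 : γ < 1) {t D : ℕ}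
    (h1 : ∀ s, 1 ≤ s → s ≤ t → |w s| ≤ 1) (h0 : ∀ s, 1 ≤ s → s ≤ t → t < s + D → w s = 0) :
    |discSum γ A w t i| ≤ γ ^ D / (1 - γ) := by
  have hpos : 0 < 1 - γ := by linarith
  rcases Nat.lt_or_ge t D with ht | ht
  · rw [discSum_eq_of_eq_zero (Nat.zero_le t) fun s h2 h3 => h0 s (by omega) h3 (by omega),
      discSum_zero, mul_zero, abs_zero]
    positivity
  · rw [discSum_eq_of_eq_zero (Nat.sub_le t D) fun s h2 h3 => h0 s (by omega) h3 (by omega),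
      abs_mul, abs_of_nonneg (pow_nonneg hγ _), show t - (t - D) = D by omega, div_eq_mul_one_div]
    gcongr
    have hup := discSum_le (A := A) (w := w) (i := i) (t := t - D) (B := 1) hγ
      fun s h2 h3 _ => (abs_le.1 (h1 s h2 (by omega))).2
    have hlow := discSum_le (A := A) (w := fun s => -w s) (i := i) (t := t - D) (B := 1) hγ
      fun s h2 h3 _ => neg_le.1 (abs_le.1 (h1 s h2 (by omega))).1
    have hneg : discSum γ A (fun s => -w s) (t - D) i = -discSum γ A w (t - D) i := by
      unfold discSum
      rw [← Finset.sum_neg_distrib]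
      refine Finset.sum_congr rfl fun s _ => ?_
      split_ifs <;> ring
    have hN := discCount_le_inv (A := A) (i := i) hγ hγ1 (t - D)
    rw [abs_le]
    constructor <;> linarith

lemma discSum_sub_const (μ : ℝ) (t : ℕ) :
    discSum γ A (fun s => w s - μ) t i = discSum γ A w t i - μ * discCount γ A t i := by
  unfold discSum discCount
  rw [Finset.mul_sum, ← Finset.sum_sub_distrib]
  refine Finset.sum_congr rfl fun s _ => ?_
  split_ifs <;> ring

lemma discSum_sub (v : ℕ → ℝ) (t : ℕ) :
    discSum γ A (fun s => w s - v s) t i = discSum γ A w t i - discSum γ A v t i := by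
  unfold discSum
  rw [← Finset.sum_sub_distrib]
  refine Finset.sum_congr rfl fun s _ => ?_
  split_ifs <;> ring

end Bias

/-! ### Breakpoints, transient rounds and measurability. -/

section Environment

variable {Ω : Type*} {mΩ : MeasurableSpace Ω} {P : Measure Ω} {ℱ : Filtration ℕ mΩ} {K T : ℕ}
  {X : ℕ → Fin K → Ω → ℝ} {A g : ℕ → Ω → Fin K} {r : ℕ → Ω → ℝ}

lemma IsRewardProcess.integral_mem_Icc [IsProbabilityMeasure P] (hX : IsRewardProcess T P ℱ X)
    {s : ℕ} (h1 : 1 ≤ s) (h2 : s ≤ T) (i : Fin K) : ∫ ω, X s i ω ∂P ∈ Set.Icc (0 : ℝ) 1 := by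
  have hmem := hX.mem_Icc s (Finset.mem_Icc.2 ⟨h1, h2⟩) i
  constructor
  · exact integral_nonneg_of_ae (hmem.mono fun ω h => h.1)
  · calc ∫ ω, X s i ω ∂P ≤ ∫ _, (1 : ℝ) ∂P := by
          refine integral_mono_ae ?_ (integrable_const _) (hmem.mono fun ω h => h.2)
          refine Integrable.of_bound (hX.measurable h1 h2 i).aestronglyMeasurable 1
            (hmem.mono fun ω h => ?_)
          rw [Real.norm_eq_abs, abs_of_nonneg h.1]
          exact h.2
      _ = 1 := by simp

lemma IsRewardProcess.integral_eq_of_notMem_breakpoints (hX : IsRewardProcess T P ℱ X) {s : ℕ}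
    (h1 : 1 ≤ s) (h2 : s < T) (hs : s ∉ breakpoints T P X) (i : Fin K) :
    ∫ ω, X (s + 1) i ω ∂P = ∫ ω, X s i ω ∂P := by
  have h : P.map (X (s + 1) i) = P.map (X s i) := by
    by_contra hne
    refine hs ?_
    simp only [breakpoints, Finset.mem_filter, Finset.mem_Ico]
    exact ⟨⟨h1, h2⟩, i, hne⟩
  have hm1 := hX.measurable (s := s + 1) (by omega) (by omega) i
  have hm2 := hX.measurable (s := s) (by omega) (by omega) i
  have e1 := integral_map (μ := P) hm1.aemeasurable (f := fun y : ℝ => y)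
    measurable_id.aestronglyMeasurable
  have e2 := integral_map (μ := P) hm2.aemeasurable (f := fun y : ℝ => y)
    measurable_id.aestronglyMeasurable
  rw [← e1, ← e2, h]

open Classical in
/-- The rounds that are close to the beginning or to a breakpoint. -/
def transientTimes (T D : ℕ) (B : Finset ℕ) : Finset ℕ :=
  (Finset.range T).filter fun t => t < D ∨ ∃ τ ∈ B, τ ≤ t ∧ t < τ + D

lemma card_transientTimes_le (T D : ℕ) (B : Finset ℕ) :
    (transientTimes T D B).card ≤ D + B.card * D := by
  classical
  have hsub : transientTimes T D B ⊆
      Finset.range D ∪ B.biUnion fun τ => Finset.Ico τ (τ + D) := by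
    intro t ht
    obtain ⟨_, h | ⟨τ, hτ, h1, h2⟩⟩ := Finset.mem_filter.1 ht
    · exact Finset.mem_union_left _ (Finset.mem_range.2 h)
    · exact Finset.mem_union_right _ (Finset.mem_biUnion.2 ⟨τ, hτ, Finset.mem_Ico.2 ⟨h1, h2⟩⟩)
  calc _ ≤ _ := Finset.card_le_card hsub
    _ ≤ _ := Finset.card_union_le _ _
    _ ≤ D + B.card * D := by
        rw [Finset.card_range]
        gcongr
        exact Finset.card_biUnion_le_card_mul _ _ _ fun τ _ => by simp

lemma IsRewardProcess.integral_eq_of_notMem_transientTimes (hX : IsRewardProcess T P ℱ X)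
    {t D : ℕ} (ht : t < T) (htr : t ∉ transientTimes T D (breakpoints T P X)) (i : Fin K) {s : ℕ}
    (h1 : 1 ≤ s) (h2 : s ≤ t + 1) (h3 : t < s + D) :
    ∫ ω, X s i ω ∂P = ∫ ω, X (t + 1) i ω ∂P := by
  obtain ⟨k, hk⟩ := Nat.exists_eq_add_of_le h2
  induction k generalizing s with
  | zero => rw [hk, add_zero]
  | succ k ih =>
    rw [← ih (s := s + 1) (by omega) (by omega) (by omega) (by omega)]
    refine (hX.integral_eq_of_notMem_breakpoints h1 (by omega) (fun hmem => htr ?_) i).symm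
    exact Finset.mem_filter.2 ⟨Finset.mem_range.2 ht, Or.inr ⟨s, hmem, by omega, h3⟩⟩

/-- Outside the deviation event and the transient times, the rewards are concentrated around the
current means. -/
lemma IsRewardProcess.isConcentrated [IsProbabilityMeasure P] (hX : IsRewardProcess T P ℱ X)
    {γ L : ℝ} (hγ : 0 ≤ γ) (hγ1 : γ < 1) {t D J : ℕ} (ht : t < T)
    (htr : t ∉ transientTimes T D (breakpoints T P X)) {ω : Ω}
    (hL : L = Real.log (discTotal γ (fun s => A s ω) t))
    (hω : ω ∉ deviationEvent P X A γ L J t) :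
    IsConcentrated γ (γ ^ D / (1 - γ)) J (fun s => A s ω) (fun s i => X s i ω) t
      (fun i => ∫ ω', X (t + 1) i ω' ∂P) := by
  intro i j hj
  simp only [deviationEvent, Set.mem_iUnion, not_exists, Set.mem_ofPred_eq, not_lt] at hω
  have h1 := hω i j (Finset.mem_range.2 (by omega))
  rw [discSum_sub, hL] at h1
  have h2 : |discSum γ (fun s => A s ω) (fun s => (∫ ω', X s i ω' ∂P) -
      ∫ ω', X (t + 1) i ω' ∂P) t i| ≤ γ ^ D / (1 - γ) := by
    refine abs_discSum_le_of_recent_eq_zero hγ hγ1 (fun s hs1 hs2 => ?_) fun s hs1 hs2 hs3 => ?_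
    · have e1 := hX.integral_mem_Icc hs1 (by omega) i
      have e2 := hX.integral_mem_Icc (s := t + 1) (by omega) (by omega) i
      rw [abs_le]
      constructor <;> linarith [e1.1, e1.2, e2.1, e2.2]
    · rw [hX.integral_eq_of_notMem_transientTimes ht htr i hs1 (by omega) hs3, sub_self]
  rw [discSum_sub_const] at h2
  calc _ = |(discSum γ (fun s => A s ω) (fun s => X s i ω) t i -
        discSum γ (fun s => A s ω) (fun s => ∫ ω', X s i ω' ∂P) t i) +
        (discSum γ (fun s => A s ω) (fun s => ∫ ω', X s i ω' ∂P) t i -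
        (∫ ω', X (t + 1) i ω' ∂P) * discCount γ (fun s => A s ω) t i)| := by congr 1; ring
    _ ≤ _ := abs_add_le _ _
    _ ≤ _ := by linarith

lemma measurable_apply_fin {Y : Ω → Fin K} {F : Fin K → Ω → ℝ} (hY : Measurable Y)
    (hF : ∀ i, Measurable (F i)) : Measurable fun ω => F (Y ω) ω := by
  have h : (fun ω => F (Y ω) ω) = fun ω => ∑ i, if Y ω = i then F i ω else 0 := by
    ext ω; simp
  rw [h]
  exact Finset.measurable_fun_sum _ fun i _ =>
    Measurable.ite (measurableSet_pull hY i) (hF i) measurable_const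

section Measurability

variable {γ : ℝ} {l : ℝ≥0} {f : ℕ → ℝ → ℝ} (hX : IsRewardProcess T P ℱ X) (hf : IsDrift T l f)
  (hA : ∀ t, t < T → Measurable (A (t + 1)))
  (hR : ∀ ω, IsIncentivizedRun T γ f (fun t i => X t i ω) (fun t => A t ω) (fun t => g t ω)
    (fun t => r t ω))

-- The greedy arm need not be chosen measurably; its empirical mean is a finite supremum of
-- measurable functions.
include hA hR in
lemma measurable_compensation {t : ℕ} (ht : t < T)
    (hr : ∀ s, 1 ≤ s → s ≤ t → Measurable (r s)) :
    Measurable fun ω => compensation γ (fun t => A t ω) (fun t => g t ω) (fun t => r t ω) t := by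
  have hA' : ∀ s, 1 ≤ s → s ≤ t → Measurable (A s) := by
    intro s h1 h2
    obtain ⟨s, rfl⟩ : ∃ s', s = s' + 1 := ⟨s - 1, by omega⟩
    exact hA s (by omega)
  have hm : ∀ i, Measurable fun ω => discMean γ (fun t => A t ω) (fun t => r t ω) t i := by
    intro i
    simp_rw [discMean_eq, discCount_eq_discSum]
    exact (measurable_discSum hA' hr).div (measurable_discSum hA' fun _ _ _ => measurable_const)
  unfold compensation
  refine Measurable.sub ?_ (measurable_apply_fin
    (F := fun i ω => discMean γ (fun t => A t ω) (fun t => r t ω) t i) (hA t ht) hm)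
  have hsup : (fun ω => discMean γ (fun t => A t ω) (fun t => r t ω) t (g (t + 1) ω)) =
      fun ω => ⨆ i, discMean γ (fun t => A t ω) (fun t => r t ω) t i := by
    ext ω
    have : Nonempty (Fin K) := ⟨A (t + 1) ω⟩
    exact le_antisymm (le_ciSup (f := fun i => discMean γ (fun t => A t ω) (fun t => r t ω) t i)
      (Set.finite_range _).bddAbove _) (ciSup_le ((hR ω).greedy t ht))
  rw [hsup]
  exact Measurable.iSup hm

include hX hf hA hR in
lemma measurable_feedback {s : ℕ} (h1 : 1 ≤ s) (h2 : s ≤ T) : Measurable (r s) := by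
  induction s using Nat.strong_induction_on with
  | _ s ih =>
  obtain ⟨s, rfl⟩ : ∃ s', s = s' + 1 := ⟨s - 1, by omega⟩
  have hc := measurable_compensation hA hR (t := s) (by omega)
    fun q h1 h2 => ih q (by omega) h1 (by omega)
  have hr : r (s + 1) = fun ω => X (s + 1) (A (s + 1) ω) ω + f (s + 1)
      (compensation γ (fun t => A t ω) (fun t => g t ω) (fun t => r t ω) s) := by
    ext ω
    exact (hR ω).feedback_eq hf (by omega)
  rw [hr]
  refine Measurable.add (measurable_apply_fin (hA s (by omega))
    fun i => hX.measurable h1 h2 i) ?_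
  exact (hf.lipschitz (s + 1) (Finset.mem_Icc.2 ⟨h1, h2⟩)).continuous.measurable.comp hc

include hX hf hA hR in
lemma measurable_armCompensation (a : Fin K) : Measurable fun ω =>
    armCompensation γ (fun t => A t ω) (fun t => g t ω) (fun t => r t ω) T a := by
  unfold armCompensation
  refine Finset.measurable_fun_sum _ fun t ht => ?_
  have ht := Finset.mem_range.1 ht
  exact Measurable.ite (measurableSet_pull (hA t ht) a) (measurable_compensation hA hR ht
    fun s h1 h2 => measurable_feedback hX hf hA hR h1 (by omega)) measurable_const

end Measurability

end Environment

/-! ### Summation over the rounds and the choice of the transient length. -/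

section Total

lemma armCompensation_le {K T D : ℕ} {γ m C : ℝ} {A g : ℕ → Fin K} {r : ℕ → ℝ} {Tr : Finset ℕ}
    {p : ℕ → ℝ} {a : Fin K} (hγ : 0 ≤ γ) (hγ1 : γ ≤ 1) (hm : 0 ≤ m) (hC : 0 ≤ C)
    (hle : ∀ t, t < T → compensation γ A g r t ≤ C) (hp : ∀ t, 0 ≤ p t)
    (hTr : ∀ t, t < T → t ∉ Tr → D ≤ t)
    (hzero : ∀ t, t < T → K ≤ t → t ∉ Tr → p t < 1 → m ≤ discCount γ A t (A (t + 1)) →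
      compensation γ A g r t = 0) :
    armCompensation γ A g r T a ≤ C * (K + Tr.card + (m + 1) * (1 + (1 - γ) * T) +
      ∑ t ∈ (Finset.range T).filter (D ≤ ·), p t) := by
  classical
  have hpull := card_pulls_le (A := A) hγ hγ1 hm a T
  have hK : ∑ t ∈ Finset.range T, (if t < K then (1 : ℝ) else 0) ≤ K := by
    rw [Finset.sum_boole]
    have : (Finset.range T).filter (· < K) ⊆ Finset.range K := fun t ht =>
      Finset.mem_range.2 (Finset.mem_filter.1 ht).2
    exact_mod_cast (Finset.card_le_card this).trans (by simp)
  have hT : ∑ t ∈ Finset.range T, (if t ∈ Tr then (1 : ℝ) else 0) ≤ Tr.card := by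
    rw [Finset.sum_boole]
    exact_mod_cast Finset.card_le_card fun t ht => (Finset.mem_filter.1 ht).2
  have hterm : ∀ t ∈ Finset.range T, (if A (t + 1) = a then compensation γ A g r t else 0) ≤
      C * ((if t < K then (1 : ℝ) else 0) + (if t ∈ Tr then (1 : ℝ) else 0) +
      (if A (t + 1) = a ∧ discCount γ A t a < m then (1 : ℝ) else 0) +
      if D ≤ t then p t else 0) := by
    intro t ht
    have ht := Finset.mem_range.1 ht
    have h1 : (0 : ℝ) ≤ if t < K then (1 : ℝ) else 0 := by split_ifs <;> norm_num
    have h2 : (0 : ℝ) ≤ if t ∈ Tr then (1 : ℝ) else 0 := by split_ifs <;> norm_num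
    have h3 : (0 : ℝ) ≤ if A (t + 1) = a ∧ discCount γ A t a < m then (1 : ℝ) else 0 := by
      split_ifs <;> norm_num
    have h4 : 0 ≤ if D ≤ t then p t else 0 := by
      split_ifs
      · exact hp t
      · exact le_rfl
    have hlarge : ∀ y, 1 ≤ y → compensation γ A g r t ≤ C * y := fun y hy =>
      (hle t ht).trans (le_mul_of_one_le_right hC hy)
    by_cases hA : A (t + 1) = a
    · rw [if_pos hA]
      by_cases c1 : t < K
      · exact hlarge _ (by rw [if_pos c1]; linarith)
      by_cases c2 : t ∈ Tr
      · exact hlarge _ (by rw [if_pos c2]; linarith)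
      by_cases c3 : discCount γ A t a < m
      · exact hlarge _ (by rw [if_pos (⟨hA, c3⟩ : _ ∧ _)]; linarith)
      by_cases c4 : p t < 1
      · rw [hzero t ht (by omega) c2 c4 (by rw [hA]; exact not_lt.1 c3)]
        exact mul_nonneg hC (by linarith)
      · exact hlarge _ (by rw [if_pos (hTr t ht c2)]; linarith)
    · rw [if_neg hA]
      exact mul_nonneg hC (by linarith)
  calc armCompensation γ A g r T a ≤ _ := Finset.sum_le_sum hterm
    _ = C * (∑ t ∈ Finset.range T, (if t < K then (1 : ℝ) else 0) +
        ∑ t ∈ Finset.range T, (if t ∈ Tr then (1 : ℝ) else 0) +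
        (((Finset.range T).filter fun t => A (t + 1) = a ∧ discCount γ A t a < m).card : ℝ) +
        ∑ t ∈ (Finset.range T).filter (D ≤ ·), p t) := by
      rw [← Finset.mul_sum, Finset.sum_add_distrib, Finset.sum_add_distrib,
        Finset.sum_add_distrib, Finset.sum_boole (fun t => A (t + 1) = a ∧ discCount γ A t a < m),
        Finset.sum_filter]
    _ ≤ _ := by gcongr

variable {Ω : Type*} {mΩ : MeasurableSpace Ω} {P : Measure Ω} {ℱ : Filtration ℕ mΩ} {K T : ℕ}
  {X : ℕ → Fin K → Ω → ℝ} {A g : ℕ → Ω → Fin K} {r : ℕ → Ω → ℝ}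

/-- Bound for the expected compensation in terms of the length `D` of the transient phases. -/
theorem integrable_armCompensation_and_integral_le [IsProbabilityMeasure P] {ξ γ γ₀ Δ M : ℝ}
    {l : ℝ≥0} {f : ℕ → ℝ → ℝ} {D J : ℕ} (hK : 2 ≤ K) (hT : 2 ≤ T) (hξ : 1 / 2 < ξ) (hγ₀ : 0 < γ₀)
    (hγ : γ₀ ≤ γ) (hγ1 : γ < 1) (hΔ : 0 < Δ)
    (hs : IsSufficient K ξ l (countConst K ξ l γ₀) Δ J M)
    (hD1 : 1 ≤ D) (hDhalf : γ ^ D ≤ 1 / 2)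
    (hDbias : γ ^ D / (1 - γ) ≤ Δ / 16 * countConst K ξ l γ₀)
    (hX : IsRewardProcess T P ℱ X) (hgap : HasGap T Δ P X) (hf : IsDrift T l f)
    (hA : ∀ t, t < T → Measurable[ℱ t] (A (t + 1)))
    (hU : ∀ ω, IsDUCB T ξ γ (fun t => A t ω) (fun t => r t ω))
    (hR : ∀ ω, IsIncentivizedRun T γ f (fun t i => X t i ω) (fun t => A t ω) (fun t => g t ω)
      (fun t => r t ω)) (a : Fin K) :
    Integrable (fun ω => armCompensation γ (fun t => A t ω) (fun t => g t ω) (fun t => r t ω) T a)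
      P ∧
    ∫ ω, armCompensation γ (fun t => A t ω) (fun t => g t ω) (fun t => r t ω) T a ∂P ≤
      compensationConst K ξ l (countConst K ξ l γ₀) * √(Real.log T) *
        (K + (D + (breakpoints T P X).card * D) +
          (M * Real.log T + 1) * (1 + (1 - γ) * T) + T * (4 * K * (J + 1) * (1 - γ))) := by
  have hξ0 : 0 ≤ ξ := by linarith
  have hγ0 : 0 < γ := hγ₀.trans_le hγ
  set κ := countConst K ξ l γ₀ with hκdef
  have hκ : 0 < κ := countConst_pos hγ₀
  set C := compensationConst K ξ l κ * √(Real.log T) with hCdef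
  have hl : (0 : ℝ) ≤ l := l.2
  have hC : 0 ≤ C := by
    rw [hCdef, compensationConst]
    positivity
  have hlogT : 0 ≤ Real.log T := Real.log_natCast_nonneg T
  have hm : 0 ≤ M * Real.log T := mul_nonneg hs.pos.le hlogT
  have hgood : ∀ᵐ ω ∂P, ∀ t, t < T → ∀ i, X (t + 1) i ω ∈ Set.Icc (0 : ℝ) 1 := by
    rw [ae_all_iff]
    intro t
    by_cases ht : t < T
    · filter_upwards [ae_all_iff.2 fun i =>
        hX.mem_Icc (t + 1) (Finset.mem_Icc.2 ⟨by omega, by omega⟩) i] with ω hω _ using hω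
    · exact Filter.Eventually.of_forall fun ω h => absurd h ht
  have hN : ∀ ω, (∀ t, t < T → ∀ i, X (t + 1) i ω ∈ Set.Icc (0 : ℝ) 1) →
      ∀ t, K ≤ t → t ≤ T → ∀ i, κ ≤ discCount γ (fun s => A s ω) t i := fun ω hω t h1 h2 i =>
    countConst_le_discCount hK hγ₀ hγ hγ1.le (by linarith) (hU ω) (hR ω) hf hω h1 h2 i
  have hcomp : ∀ ω, (∀ t, t < T → ∀ i, X (t + 1) i ω ∈ Set.Icc (0 : ℝ) 1) → ∀ t, t < T →
      compensation γ (fun t => A t ω) (fun t => g t ω) (fun t => r t ω) t ≤ C := fun ω hω t ht =>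
    compensation_le_const hγ0.le hγ1.le hξ0 hκ (hU ω) (hR ω) hf hω (hN ω hω) hT ht
  have hint : Integrable (fun ω =>
      armCompensation γ (fun t => A t ω) (fun t => g t ω) (fun t => r t ω) T a) P := by
    refine Integrable.of_bound (measurable_armCompensation hX hf
      (fun t ht => (hA t ht).mono (ℱ.le t) le_rfl) hR a).aestronglyMeasurable (T * C) ?_
    filter_upwards [hgood] with ω hω
    have h0 : ∀ t ∈ Finset.range T, (0 : ℝ) ≤ if A (t + 1) ω = a then
        compensation γ (fun t => A t ω) (fun t => g t ω) (fun t => r t ω) t else 0 := by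
      intro t ht
      split_ifs
      · exact (hR ω).compensation_nonneg (Finset.mem_range.1 ht)
      · exact le_rfl
    rw [Real.norm_eq_abs, armCompensation, abs_of_nonneg (Finset.sum_nonneg h0)]
    calc _ ≤ ∑ t ∈ Finset.range T, C := by
          refine Finset.sum_le_sum fun t ht => ?_
          split_ifs
          · exact hcomp ω hω t (Finset.mem_range.1 ht)
          · exact hC
      _ = T * C := by simp
  refine ⟨hint, ?_⟩
  set Tr := transientTimes T D (breakpoints T P X) with hTrdef
  -- `n_t(γ)` is a geometric sum that does not depend on the pulls, so the deviation threshold is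
  -- deterministic.
  set L : ℕ → ℝ := fun t => Real.log (∑ j ∈ Finset.range t, γ ^ j) with hL
  set E : ℕ → Set Ω := fun t => deviationEvent P X A γ (L t) J t with hE
  have hEm : ∀ t, t < T → MeasurableSet (E t) := fun t ht =>
    hX.measurableSet_deviationEvent hA γ (L t) J ht.le
  have hEP : ∀ t, D ≤ t → t < T → P.real (E t) ≤ 4 * K * (J + 1) * (1 - γ) := by
    intro t hDt ht
    have h1 := hX.measure_deviationEvent_le hA hγ0.le hγ1.le (L t) J ht.le
    have htot : 1 ≤ ∑ j ∈ Finset.range t, γ ^ j := by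
      have := one_le_discTotal (A := fun _ => a) (γ := γ) (t := t) hγ0.le (by omega)
      rwa [discTotal_eq_sum] at this
    have hhalf : 1 / 2 ≤ (1 - γ) * ∑ j ∈ Finset.range t, γ ^ j := by
      have := one_sub_mul_discTotal (A := fun _ => a) (γ := γ) (t := t)
      rw [discTotal_eq_sum] at this
      rw [this]
      linarith [pow_le_pow_of_le_one hγ0.le hγ1.le hDt]
    -- `exp (-L t)` is `1 / n_t(γ)`, and `n_t(γ) ≥ 1 / (2 * (1 - γ))` once `γ ^ t ≤ 1 / 2`.
    have hexp : Real.exp (-L t) ≤ 2 * (1 - γ) := by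
      rw [hL, Real.exp_neg, Real.exp_log (by linarith), inv_le_iff_one_le_mul₀ (by linarith)]
      linarith
    have h2 : P.real (E t) ≤ 2 * K * (J + 1) * Real.exp (-L t) :=
      ENNReal.toReal_le_of_le_ofReal (by positivity) h1
    calc P.real (E t) ≤ 2 * K * (J + 1) * Real.exp (-L t) := h2
      _ ≤ 2 * K * (J + 1) * (2 * (1 - γ)) := by gcongr
      _ = _ := by ring
  have hTrD : ∀ t, t < T → t ∉ Tr → D ≤ t := by
    intro t ht h
    by_contra! hcon
    exact h (Finset.mem_filter.2 ⟨Finset.mem_range.2 ht, Or.inl hcon⟩)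
  set F := (Finset.range T).filter (D ≤ ·) with hF
  set B := (K + Tr.card + (M * Real.log T + 1) * (1 + (1 - γ) * T) : ℝ) with hB
  have hpath : ∀ᵐ ω ∂P,
      armCompensation γ (fun t => A t ω) (fun t => g t ω) (fun t => r t ω) T a ≤
        C * (B + ∑ t ∈ F, (E t).indicator (fun _ => (1 : ℝ)) ω) := by
    filter_upwards [hgood] with ω hω
    refine armCompensation_le (p := fun t => (E t).indicator (fun _ => (1 : ℝ)) ω)
      hγ0.le hγ1.le hm hC (hcomp ω hω)
      (fun t => Set.indicator_nonneg (fun _ _ => zero_le_one) ω) hTrD ?_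
    intro t ht hKt htr hp hmt
    have hωE : ω ∉ E t := by
      intro h
      simp [h] at hp
    obtain ⟨b, hb⟩ := hgap (t + 1) (Finset.mem_Icc.2 ⟨by omega, by omega⟩)
    have hconc := hX.isConcentrated hγ0.le hγ1 ht htr (L := L t) (J := J) (A := A) (ω := ω)
      (by rw [discTotal_eq_sum]) hωE
    exact compensation_eq_zero hγ0.le hγ1.le hκ hs hΔ hDbias (hU ω) (hR ω) hf hω (hN ω hω) hT ht
      hKt hconc hξ (fun i => (hX.integral_mem_Icc (by omega) (by omega) i).2) b hb hmt
  have hindi : ∀ t ∈ F, Integrable ((E t).indicator fun _ => (1 : ℝ)) P := fun t ht =>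
    (integrable_const _).indicator (hEm t (Finset.mem_range.1 (Finset.mem_filter.1 ht).1))
  have hsumi : Integrable (fun ω => ∑ t ∈ F, (E t).indicator (fun _ => (1 : ℝ)) ω) P :=
    integrable_finsetSum _ hindi
  calc ∫ ω, armCompensation γ (fun t => A t ω) (fun t => g t ω) (fun t => r t ω) T a ∂P
      ≤ ∫ ω, C * (B + ∑ t ∈ F, (E t).indicator (fun _ => (1 : ℝ)) ω) ∂P :=
        integral_mono_ae hint (((integrable_const _).add hsumi).const_mul _) hpath
    _ = C * (B + ∑ t ∈ F, P.real (E t)) := by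
        rw [integral_const_mul, integral_add (integrable_const _) hsumi,
          integral_finsetSum _ hindi]
        congr 2
        · simp
        · refine Finset.sum_congr rfl fun t ht => ?_
          rw [integral_indicator (hEm t (Finset.mem_range.1 (Finset.mem_filter.1 ht).1))]
          simp
    _ ≤ _ := by
        have h1 : ∑ t ∈ F, P.real (E t) ≤ T * (4 * K * (J + 1) * (1 - γ)) := by
          have hpos : (0 : ℝ) ≤ 4 * K * (J + 1) * (1 - γ) :=
            mul_nonneg (by positivity) (by linarith)
          calc ∑ t ∈ F, P.real (E t) ≤ ∑ t ∈ F, 4 * K * (J + 1) * (1 - γ) :=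
                Finset.sum_le_sum fun t ht => hEP t (Finset.mem_filter.1 ht).2
                  (Finset.mem_range.1 (Finset.mem_filter.1 ht).1)
            _ = F.card * (4 * K * (J + 1) * (1 - γ)) := by simp
            _ ≤ _ := by
                gcongr
                exact (Finset.card_filter_le _ _).trans (by simp)
        have h2 : (Tr.card : ℝ) ≤ D + (breakpoints T P X).card * D := by
          exact_mod_cast card_transientTimes_le T D (breakpoints T P X)
        rw [hB]
        gcongr

lemma armCompensation_eq_zero_of_subsingleton {γ : ℝ} {K : ℕ} (hK : K ≤ 1) (A g : ℕ → Fin K)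
    (r : ℕ → ℝ) (T : ℕ) (a : Fin K) : armCompensation γ A g r T a = 0 := by
  have : Subsingleton (Fin K) := Fin.subsingleton_iff_le_one.2 hK
  refine Finset.sum_eq_zero fun t _ => ?_
  rw [compensation, Subsingleton.elim (g (t + 1)) (A (t + 1)), sub_self, ite_self]

/-- Length of the transient phases. -/
lemma exists_transient_length {γ δ c T : ℝ} (hγ : 0 ≤ γ) (hγ1 : γ < 1) (hδ : 0 < δ)
    (hδ1 : δ ≤ 1 / 2) (hT : 1 ≤ T) (hcT : c ≤ (1 - γ) * T) (hc : 0 < c) :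
    ∃ D : ℕ, 1 ≤ D ∧ γ ^ D ≤ 1 / 2 ∧ γ ^ D / (1 - γ) ≤ δ / c ∧
      D * (1 - γ) ≤ Real.log T + (1 - Real.log δ) := by
  have hpos : 0 < 1 - γ := by linarith
  have hlogT : 0 ≤ Real.log T := Real.log_nonneg hT
  have hlogδ : Real.log δ < 0 := Real.log_neg hδ (by linarith)
  -- Chosen so that `γ ^ D ≤ δ / T`; the bias is then at most `δ / ((1 - γ) * T) ≤ δ / c`.
  set D := ⌈(Real.log T - Real.log δ) / (1 - γ)⌉₊ with hD
  have hD1 : (Real.log T - Real.log δ) / (1 - γ) ≤ D := Nat.le_ceil _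
  have hD2 : (D : ℝ) < (Real.log T - Real.log δ) / (1 - γ) + 1 :=
    Nat.ceil_lt_add_one (div_nonneg (by linarith) hpos.le)
  have hpow : γ ^ D ≤ δ / T := by
    have h1 : γ ≤ Real.exp (-(1 - γ)) := by
      have := Real.add_one_le_exp (-(1 - γ))
      linarith
    calc γ ^ D ≤ Real.exp (-(1 - γ)) ^ D := by gcongr
      _ = Real.exp (-(D * (1 - γ))) := by rw [← Real.exp_nat_mul]; ring_nf
      _ ≤ Real.exp (Real.log δ - Real.log T) := by
          apply Real.exp_le_exp.2
          rw [div_le_iff₀ hpos] at hD1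
          linarith
      _ = δ / T := by rw [Real.exp_sub, Real.exp_log hδ, Real.exp_log (by linarith)]
  refine ⟨D, Nat.ceil_pos.2 (div_pos (by linarith) hpos), ?_, ?_, ?_⟩
  · exact hpow.trans ((div_le_self hδ.le hT).trans hδ1)
  · calc γ ^ D / (1 - γ) ≤ δ / T / (1 - γ) := by gcongr
      _ = δ / ((1 - γ) * T) := by rw [div_div, mul_comm T]
      _ ≤ δ / c := by gcongr
  · calc D * (1 - γ) ≤ ((Real.log T - Real.log δ) / (1 - γ) + 1) * (1 - γ) := by gcongr
      _ = Real.log T - Real.log δ + (1 - γ) := by field_simp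
      _ ≤ _ := by linarith

end Total

/-! ### Arithmetic of the final bound and the main theorem. -/

/-- Constant in the final bound, with `q` governing the length of the transient phases. -/
def totalConst (K J : ℕ) (M c q : ℝ) : ℝ :=
  K / Real.log 2 + 2 * (1 + q / Real.log 2) / c + (M + 1 / Real.log 2) * (1 + c) +
    4 * K * (J + 1) * c / Real.log 2

lemma total_le {K J D β T : ℕ} {M c q γ : ℝ} (hM : 0 < M) (hc : 0 < c) (hq : 0 ≤ q) (hT : 2 ≤ T)
    (hβ : 1 ≤ β) (hγ : γ = 1 - c * √((β : ℝ) / (T : ℝ)))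
    (hD : D * (1 - γ) ≤ Real.log T + q) :
    K + (D + (β : ℝ) * D) + (M * Real.log T + 1) * (1 + (1 - γ) * T) +
      T * (4 * K * (J + 1) * (1 - γ)) ≤
      totalConst K J M c q * (√β * √T * Real.log T) := by
  have hℓ₂ : 0 < Real.log 2 := Real.log_pos (by norm_num)
  have hℓ : Real.log 2 ≤ Real.log T := Real.log_le_log (by norm_num) (by exact_mod_cast hT)
  have hβ1 : (1 : ℝ) ≤ β := by exact_mod_cast hβ
  have hT1 : (1 : ℝ) ≤ T := by exact_mod_cast (by omega : 1 ≤ T)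
  have hu : 1 ≤ √(β : ℝ) := Real.one_le_sqrt.2 hβ1
  have hv : 1 ≤ √(T : ℝ) := Real.one_le_sqrt.2 hT1
  have hu2 : (β : ℝ) = √(β : ℝ) ^ 2 := (Real.sq_sqrt (by linarith)).symm
  have hv2 : (T : ℝ) = √(T : ℝ) ^ 2 := (Real.sq_sqrt (by linarith)).symm
  have h1γ : 1 - γ = c * (√(β : ℝ) / √(T : ℝ)) := by
    rw [hγ, Real.sqrt_div (by linarith)]; ring
  set u := √(β : ℝ)
  set v := √(T : ℝ)
  set ℓ := Real.log T
  have hone : 1 ≤ ℓ / Real.log 2 := (one_le_div hℓ₂).2 hℓ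
  have huv : 1 ≤ u * v := one_le_mul_of_one_le_of_one_le hu hv
  have hγT : (1 - γ) * T = c * (u * v) := by
    rw [h1γ, hv2]
    field_simp
  -- The tuning of `γ` balances the transient rounds: `1 - γ = c * u / v` turns `β * D` into `D * (1
  -- - γ)` times `u * v / c`.
  have hDβ : (β : ℝ) * D ≤ (1 + q / Real.log 2) / c * (u * v * ℓ) := by
    rw [h1γ] at hD
    have h1 : ℓ + q ≤ (1 + q / Real.log 2) * ℓ := by
      have : q * 1 ≤ q * (ℓ / Real.log 2) := by gcongr
      calc ℓ + q ≤ ℓ + q * (ℓ / Real.log 2) := by linarith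
        _ = _ := by ring
    calc (β : ℝ) * D = D * (c * (u / v)) * (u * v / c) := by
          rw [hu2]; field_simp
      _ ≤ (1 + q / Real.log 2) * ℓ * (u * v / c) := by
          exact mul_le_mul_of_nonneg_right (hD.trans h1) (by positivity)
      _ = _ := by ring
  have hDD : (D : ℝ) ≤ β * D := le_mul_of_one_le_left (by positivity) hβ1
  have hKle : (K : ℝ) ≤ K / Real.log 2 * (u * v * ℓ) := by
    calc (K : ℝ) = K * (1 * 1) := by ring
      _ ≤ K * (u * v * (ℓ / Real.log 2)) := by gcongr
      _ = _ := by ring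
  have hmid : (M * ℓ + 1) * (1 + (1 - γ) * T) ≤
      (M + 1 / Real.log 2) * (1 + c) * (u * v * ℓ) := by
    rw [hγT]
    calc (M * ℓ + 1) * (1 + c * (u * v)) ≤
          (M * ℓ + ℓ / Real.log 2) * (u * v + c * (u * v)) := by
          have : 0 ≤ ℓ := hℓ₂.le.trans hℓ
          gcongr
      _ = _ := by ring
  have hlast : T * (4 * K * (J + 1) * (1 - γ)) ≤
      4 * K * (J + 1) * c / Real.log 2 * (u * v * ℓ) := by
    calc T * (4 * K * (J + 1) * (1 - γ)) = 4 * K * (J + 1) * ((1 - γ) * T) * 1 := by ring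
      _ ≤ 4 * K * (J + 1) * ((1 - γ) * T) * (ℓ / Real.log 2) := by
          rw [hγT]
          gcongr
      _ = _ := by rw [hγT]; ring
  calc _ ≤ K / Real.log 2 * (u * v * ℓ) + 2 * ((1 + q / Real.log 2) / c * (u * v * ℓ)) +
        (M + 1 / Real.log 2) * (1 + c) * (u * v * ℓ) +
        4 * K * (J + 1) * c / Real.log 2 * (u * v * ℓ) := by linarith
    _ = _ := by unfold totalConst; ring

lemma totalConst_nonneg {K J : ℕ} {M c q : ℝ} (hM : 0 < M) (hc : 0 < c) (hq : 0 ≤ q) :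
    0 ≤ totalConst K J M c q := by
  have hℓ₂ : 0 < Real.log 2 := Real.log_pos (by norm_num)
  unfold totalConst
  positivity

/-- Weakens `√β` to `β ^ (3 / 2)`; the summand `1` serves to make the final constant positive. -/
lemma sqrt_mul_log_le {T β : ℕ} {C₁ C₂ : ℝ} (hC₁ : 0 ≤ C₁) (hC₂ : 0 ≤ C₂) (hT : 2 ≤ T)
    (hβ : 1 ≤ β) :
    C₁ * √(Real.log T) * (C₂ * (√β * √T * Real.log T)) ≤
      (C₁ * C₂ + 1) * (β : ℝ) ^ (3 / 2 : ℝ) * √(T : ℝ) * Real.log T ^ (3 / 2 : ℝ) := by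
  have hℓ : 0 < Real.log T := Real.log_pos (by exact_mod_cast (by omega : 1 < T))
  have hlog : Real.log T ^ (3 / 2 : ℝ) = √(Real.log T) * Real.log T := by
    rw [Real.sqrt_eq_rpow, ← Real.rpow_add_one hℓ.ne']
    norm_num
  have hβ' : √(β : ℝ) ≤ (β : ℝ) ^ (3 / 2 : ℝ) := by
    rw [Real.sqrt_eq_rpow]
    exact Real.rpow_le_rpow_of_exponent_le (by exact_mod_cast hβ) (by norm_num)
  rw [hlog]
  calc C₁ * √(Real.log T) * (C₂ * (√β * √T * Real.log T)) =
      C₁ * C₂ * √β * √T * (√(Real.log T) * Real.log T) := by ring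
    _ ≤ _ := by
      gcongr
      linarith

end IncentivizedBandit

end

theorem theorem3 (K : ℕ) (ξ : ℝ) (hξ : 1 / 2 < ξ) (l : ℝ≥0) (Δ : ℝ) (hΔ : 0 < Δ)
    (c : ℝ) (hc : 0 < c) (γ₀ : ℝ) (hγ₀ : 0 < γ₀) :
    ∃ η : ℝ, 0 < η ∧
      ∀ (Ω : Type*) (mΩ : MeasurableSpace Ω) (P : Measure Ω) (_ : IsProbabilityMeasure P)
        (ℱ : Filtration ℕ mΩ) (T β : ℕ) (γ : ℝ) (f : ℕ → ℝ → ℝ)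
        (X : ℕ → Fin K → Ω → ℝ) (A g : ℕ → Ω → Fin K) (r : ℕ → Ω → ℝ),
        IncentivizedBandit.IsRewardProcess T P ℱ X →
        IncentivizedBandit.HasGap T Δ P X →
        β = (IncentivizedBandit.breakpoints T P X).card → 1 ≤ β →
        γ = 1 - c * √((β : ℝ) / (T : ℝ)) → γ₀ ≤ γ →
        IncentivizedBandit.IsDrift T l f →
        (∀ t, t < T → Measurable[ℱ t] (A (t + 1))) →
        (∀ ω, IncentivizedBandit.IsDUCB T ξ γ (fun t => A t ω) (fun t => r t ω)) →
        (∀ ω, IncentivizedBandit.IsIncentivizedRun T γ f (fun t i => X t i ω)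
          (fun t => A t ω) (fun t => g t ω) (fun t => r t ω)) →
        ∀ a : Fin K,
          Integrable (fun ω => IncentivizedBandit.armCompensation γ
            (fun t => A t ω) (fun t => g t ω) (fun t => r t ω) T a) P ∧
          ∫ ω, IncentivizedBandit.armCompensation γ
              (fun t => A t ω) (fun t => g t ω) (fun t => r t ω) T a ∂P
            ≤ η * (β : ℝ) ^ (3 / 2 : ℝ) * √(T : ℝ) * Real.log T ^ (3 / 2 : ℝ) := by
  have hξ0 : 0 < ξ := by linarith
  have hκ := IncentivizedBandit.countConst_pos (K := K) (ξ := ξ) (l := l) hγ₀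
  set κ := IncentivizedBandit.countConst K ξ l γ₀ with hκdef
  obtain ⟨J, M, hs⟩ := IncentivizedBandit.exists_isSufficient K ξ l κ hΔ
  have hM := hs.pos
  -- With this `δ` the bias is at most `Δ / 16 * κ`, hence at most `Δ / 16` times any discounted
  -- count after the initialization.
  set δ := min (1 / 2) (c * (Δ / 16 * κ)) with hδdef
  have hδ : 0 < δ := lt_min (by norm_num) (by positivity)
  have hδ1 : δ ≤ 1 / 2 := min_le_left _ _
  have hδ2 : δ / c ≤ Δ / 16 * κ := by
    rw [div_le_iff₀ hc, mul_comm]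
    exact min_le_right _ _
  have hq : 0 ≤ 1 - Real.log δ := by linarith [Real.log_nonpos hδ.le (by linarith)]
  set C₁ := IncentivizedBandit.compensationConst K ξ l κ with hC₁def
  set C₂ := IncentivizedBandit.totalConst K J M c (1 - Real.log δ) with hC₂def
  have hl : (0 : ℝ) ≤ l := l.2
  have hC₁ : 0 ≤ C₁ := by
    rw [hC₁def, IncentivizedBandit.compensationConst]
    positivity
  have hC₂ : 0 ≤ C₂ := IncentivizedBandit.totalConst_nonneg hM hc hq
  refine ⟨C₁ * C₂ + 1, by positivity, ?_⟩
  intro Ω mΩ P hP ℱ T β γ f X A g r hX hgap hβ hβ1 hγdef hγ hf hA hU hR a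
  have hT : 2 ≤ T := by
    have hpos : 0 < (IncentivizedBandit.breakpoints T P X).card := by omega
    obtain ⟨τ, hτ⟩ := Finset.card_pos.1 hpos
    simp only [IncentivizedBandit.breakpoints, Finset.mem_filter, Finset.mem_Ico] at hτ
    omega
  have hfinal := IncentivizedBandit.sqrt_mul_log_le hC₁ hC₂ hT hβ1
  rcases Nat.lt_or_ge K 2 with hK | hK
  -- With a single arm the greedy and the pulled arm coincide, so nothing is paid.
  · have h0 : ∀ ω, IncentivizedBandit.armCompensation γ (fun t => A t ω) (fun t => g t ω)
        (fun t => r t ω) T a = 0 := fun ω =>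
      IncentivizedBandit.armCompensation_eq_zero_of_subsingleton (by omega) _ _ _ T a
    simp_rw [h0]
    refine ⟨integrable_zero _ _ _, ?_⟩
    rw [integral_zero]
    refine le_trans ?_ hfinal
    have := Real.log_natCast_nonneg T
    positivity
  · have hβpos : (1 : ℝ) ≤ β := by exact_mod_cast hβ1
    have hTpos : (1 : ℝ) ≤ T := by exact_mod_cast (by omega : 1 ≤ T)
    have hγ1 : γ < 1 := by
      have : 0 < c * √((β : ℝ) / (T : ℝ)) := by positivity
      linarith
    have hcT : c ≤ (1 - γ) * T := by
      have h1 : 1 ≤ √((β : ℝ) / T) * T := by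
        rw [Real.sqrt_div (by linarith), div_mul_eq_mul_div, le_div_iff₀ (by positivity), one_mul]
        have h2 : √(T : ℝ) ≤ T := Real.sqrt_le_iff.2 ⟨by linarith, le_self_pow₀ hTpos two_ne_zero⟩
        have h3 : 1 ≤ √(β : ℝ) := Real.one_le_sqrt.2 hβpos
        nlinarith
      calc c = c * 1 := (mul_one c).symm
        _ ≤ c * (√((β : ℝ) / T) * T) := by gcongr
        _ = (1 - γ) * T := by rw [hγdef]; ring
    obtain ⟨D, hD1, hDhalf, hDbias, hDlen⟩ := IncentivizedBandit.exists_transient_length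
      (hγ₀.le.trans hγ) hγ1 hδ hδ1 hTpos hcT hc
    obtain ⟨hint, hle⟩ := IncentivizedBandit.integrable_armCompensation_and_integral_le hK hT hξ hγ₀
      hγ hγ1 hΔ hs hD1 hDhalf (hDbias.trans hδ2) hX hgap hf hA hU hR a
    refine ⟨hint, hle.trans (le_trans ?_ hfinal)⟩
    rw [← hβ]
    gcongr
    exact IncentivizedBandit.total_le hM hc hq hT hβ1 hγdef hDlen
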